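/- Let $d\ge 1$ be an integer and let $s\ge d$ be real. For a finite complex Borel measure $\nu$ on $\mathbb{R}^d$, with total variation $\|\nu\|=|\nu|(\mathbb{R}^d)$, and for $\varepsilon>0$, $x\in\mathbb{R}^d$, put $$R^s_{\nu,\varepsilon}(x)=\int_{|y-x|>\varepsilon}\frac{y-x}{|y-x|^{s+1}}\,d\nu(y)\in\mathbb{C}^d,\qquad R^s_{\nu,*}(x)=\sup_{\varepsilon>0}|R^s_{\nu,\varepsilon}(x)|,$$ and, for $P>0$, let $\mathcal{Z}^*(\nu,P)=\{x\in\mathbb{R}^d: R^s_{\nu,*}(x)>P\}$. A measuring function is a continuous, strictly increasing function $h:[0,\infty)\to[0,\infty)$ with $h(0)=0$, $\lim_{r\to\infty}h(r)=\infty$, and $h(r)/r^d$ non-increasing on $(0,\infty)$. The Hausdorff content of $G\subset\mathbb{R}^d$ is $M_h(G)=\inf\sum_j h(r_j)$, the infimum being over all at most countable coverings of $G$ by open balls of radii $r_j$. There is a constant $C=C(s,d)>0$, depending only on $s$ and $d$, such that for every measuring function $h$, every integer $N\ge2$, every $P>0$, and every measure $\nu=\sum_{j=1}^N c_j\delta_{y_j}$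 that is a linear combination of $N$ Dirac point masses ($c_j\in\mathbb{C}$, $y_j\in\mathbb{R}^d$), $$M_h(\mathcal{Z}^*(\nu,P))\le C\,N\,h\!\left(\left(\frac{\|\nu\|}{PN}\right)^{1/s}\right).$$ -/

import Mathlib

open MeasureTheory Filter Set
open scoped NNReal ENNReal

/-- The `s`-Riesz kernel `K^s(x) = x / |x|^(s+1)` on `ℝ^d` (with value `0` at the origin, where it is
never used), regarded as a vector of `ℂ^d` so that it can be integrated against complex measures. -/
noncomputable def rieszKernel (d : ℕ) (s : ℝ) (x : EuclideanSpace ℝ (Fin d)) :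
    EuclideanSpace ℂ (Fin d) :=
  WithLp.toLp 2 fun i => ((x i / ‖x‖ ^ (s + 1) : ℝ) : ℂ)

/-- The `ε`-truncated `s`-Riesz transform
`R_{ν,ε}^s(x) = ∫_{|y - x| > ε} K^s(y - x) dν(y)` of a complex Borel measure `ν` on `ℝ^d`,
the integrand and the measure being paired by multiplication of vectors in `ℂ^d` by complex scalars. -/
noncomputable def truncatedRiesz {d : ℕ} (s : ℝ) (ν : ComplexMeasure (EuclideanSpace ℝ (Fin d)))
    (ε : ℝ) (x : EuclideanSpace ℝ (Fin d)) : EuclideanSpace ℂ (Fin d) :=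
  VectorMeasure.integral (ν.restrict {y | ε < ‖y - x‖}) (fun y => rieszKernel d s (y - x))
    (ContinuousLinearMap.lsmul ℝ ℂ :
      ℂ →L[ℝ] EuclideanSpace ℂ (Fin d) →L[ℝ] EuclideanSpace ℂ (Fin d)).flip

/-- The maximal `s`-Riesz transform `R_{ν,*}^s(x) = sup_{ε > 0} |R_{ν,ε}^s(x)|`, in `[0, ∞]`. -/
noncomputable def maximalRiesz {d : ℕ} (s : ℝ) (ν : ComplexMeasure (EuclideanSpace ℝ (Fin d)))
    (x : EuclideanSpace ℝ (Fin d)) : ℝ≥0∞ :=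
  ⨆ (ε : ℝ) (_ : 0 < ε), ‖truncatedRiesz s ν ε x‖ₑ

/-- The set `Z^*(ν, P)` of the points where the maximal `s`-Riesz transform exceeds `P`. -/
def maximalRieszSet {d : ℕ} (s : ℝ) (ν : ComplexMeasure (EuclideanSpace ℝ (Fin d))) (P : ℝ≥0) :
    Set (EuclideanSpace ℝ (Fin d)) :=
  {x | (P : ℝ≥0∞) < maximalRiesz s ν x}

/-- Measuring (gauge) functions on `[0, ∞)` in dimension `d`. -/
structure IsMeasuringFunction (d : ℕ) (h : ℝ≥0 → ℝ≥0) : Prop where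
  continuous : Continuous h
  strictMono : StrictMono h
  map_zero : h 0 = 0
  tendsto_atTop : Tendsto h atTop atTop
  antitoneOn_div : AntitoneOn (fun r => h r / r ^ d) (Ioi 0)

/-- The Hausdorff content `M_h(G)`, the infimum of `∑ h(r_j)` over the at most countable coverings
of `G` by balls `B(x_j, r_j) = {y | |y - x_j| < r_j}`. Since `B(x, 0)` is empty and `h 0 = 0` for a
measuring function, finite coverings are included as sequences with `r_j = 0` from some `j` on. -/
noncomputable def hausdorffContent {d : ℕ} (h : ℝ≥0 → ℝ≥0) (G : Set (EuclideanSpace ℝ (Fin d))) :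
    ℝ≥0∞ :=
  ⨅ (x : ℕ → EuclideanSpace ℝ (Fin d)) (r : ℕ → ℝ≥0)
    (_ : G ⊆ ⋃ j, Metric.ball (x j) (r j : ℝ)), ∑' j, (h (r j) : ℝ≥0∞)

/-- `ν` is a (complex) linear combination of `N` Dirac point masses. The points are not required to
be distinct, nor the coefficients to be nonzero. -/
def IsPointMassCombination {d : ℕ} (N : ℕ) (ν : ComplexMeasure (EuclideanSpace ℝ (Fin d))) : Prop :=
  ∃ (y : Fin N → EuclideanSpace ℝ (Fin d)) (c : Fin N → ℂ),
    ν = ∑ j, c j • VectorMeasure.dirac (y j) (1 : ℂ)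

/-- The total variation `‖ν‖ = |ν|(ℝ^d)` of a complex Borel measure (of finite total variation). -/
noncomputable def totalMass {d : ℕ} (ν : ComplexMeasure (EuclideanSpace ℝ (Fin d))) : ℝ≥0 :=
  (ν.variation univ).toNNReal

/-! Because $h(\rho)/\rho^d$ is non-increasing, it suffices to cover the set by balls of radii at
least $r$, a constant multiple of $(\|\nu\|/(PN))^{1/s}$, whose $d$-th powers of radii sum to at
most a constant times $Nr^d$ (`HasBallCover.hausdorffContent_le`). What remains is a weak type
estimate at scales above $r$. The places where averages of an integrable function over balls of
radius at least $r$ are large are covered by a Vitali argument (`hasBallCover_maximal`).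

For $s>d$ no cancellation is needed (`exists_hasBallCover_potential`). Outside the balls of radius
$2r$ about the points, the kernel is dominated by $(r+|x-y_j|)^{-s}$, which has integral of order
$r^{d-s}$ and is almost constant at scale $r$.

For $s=d$ the measure is split into four positive ones (`exists_hasBallCover_truncated_eq` treats
each). A stopping radius at each point, the last one at which its ball has density $P$, and Vitali's
lemma group the masses into clusters (`exists_isClustering`). The clusters have small total size,
and above their sizes the measure has growth $P\rho^d$. Each mass is moved to the centre of its
cluster and lifted to a height equal to the size of the cluster, which regularizes the kernel.

The $L^2$ bound for the lifted transform replaces Calderón–Zygmund theory. The field $X/|X|^{d+1}$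
in $\mathbb{R}^{d+1}$ is curl-free and divergence-free away from its pole. The Rellich identity
(`integral_inner_upperRiesz`) therefore equates the $L^2$ pairings of its horizontal parts with
those of its vertical parts. The latter are Poisson kernels: positive, and controlled by growth
alone (`exists_integral_norm_sq_upperRiesz_le`). A Cotlar type comparison
(`exists_norm_truncated_le`) bounds every truncation by a multiple of $P$ away from the clusters and
from the points where averages of the squared lifted transform or of the Poisson extension are
large. -/

/-! ### Reduction to finite sums over distinct points -/

section PointMasses

variable {d : ℕ}

/-- A finite family of points can be taken to be injective in a representation of a combination of
point masses, so that the moduli of the weights add up to the total mass. -/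
theorem IsPointMassCombination.exists_repr {N : ℕ} {ν : ComplexMeasure (EuclideanSpace ℝ (Fin d))}
    (hν : IsPointMassCombination N ν) :
    ∃ (F : Finset (EuclideanSpace ℝ (Fin d))) (c : EuclideanSpace ℝ (Fin d) → ℂ),
      F.card ≤ N ∧ ν = ∑ p ∈ F, VectorMeasure.dirac p (c p) ∧
        ∑ p ∈ F, ‖c p‖ ≤ (totalMass ν : ℝ) := by
  classical
  obtain ⟨y, c, rfl⟩ := hν
  have hsmul : ∀ j, c j • VectorMeasure.dirac (y j) (1 : ℂ) = VectorMeasure.dirac (y j) (c j) := by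
    intro j
    ext1 t ht
    by_cases h : y j ∈ t <;> simp [h, ht]
  simp only [hsmul]
  set ν : ComplexMeasure (EuclideanSpace ℝ (Fin d)) := ∑ j, VectorMeasure.dirac (y j) (c j) with hνdef
  -- Finiteness matters: `totalMass` is defined by `toNNReal`, which would send an infinite
  -- variation to 0.
  have hfin : ν.variation univ ≠ ∞ := by
    have h1 := VectorMeasure.variation_finsetSum_le Finset.univ
      (fun j => (VectorMeasure.dirac (y j) (c j) : ComplexMeasure (EuclideanSpace ℝ (Fin d))))
    have h2 := h1 univ
    refine ne_top_of_le_ne_top ?_ h2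
    simp
  set F := Finset.image y Finset.univ with hF
  -- Taking the weight of `p` to be `ν {p}` merges coincident points. The weights are then values on
  -- disjoint singletons, so their moduli sum to at most the variation.
  have hval : ν = ∑ p ∈ F, VectorMeasure.dirac p (ν {p}) := by
    have h1 : ∀ p, ν {p} = ∑ j, if y j = p then c j else 0 := by
      intro p
      rw [hνdef]
      simp only [FunLike.coe_sum, Finset.sum_apply]
      refine Finset.sum_congr rfl fun j _ => ?_
      by_cases h : y j = p <;> simp [h]
    ext1 t ht
    have h3 : ν t = ∑ j, (VectorMeasure.dirac (y j) (c j) :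
        ComplexMeasure (EuclideanSpace ℝ (Fin d))) t := by
      rw [hνdef]
      simp only [FunLike.coe_sum, Finset.sum_apply]
    have h2 : ∀ p, (VectorMeasure.dirac p (ν {p}) : ComplexMeasure (EuclideanSpace ℝ (Fin d))) t
        = ∑ j, if y j = p then (VectorMeasure.dirac (y j) (c j) : ComplexMeasure (EuclideanSpace ℝ (Fin d))) t else 0 := by
      intro p
      by_cases hp : p ∈ t
      · rw [VectorMeasure.dirac_apply_of_mem ht hp, h1]
        refine Finset.sum_congr rfl fun j _ => ?_
        by_cases h : y j = p <;> simp [h, ht, hp]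
      · rw [VectorMeasure.dirac_apply_of_notMem hp]
        symm
        refine Finset.sum_eq_zero fun j _ => ?_
        by_cases h : y j = p <;> simp [h, hp]
    rw [h3, FunLike.coe_sum, Finset.sum_apply, Finset.sum_congr rfl fun p _ => h2 p]
    rw [Finset.sum_comm]
    refine Finset.sum_congr rfl fun j _ => ?_
    simp [hF]
  refine ⟨F, fun p => ν {p}, ?_, hval, ?_⟩
  · exact Finset.card_image_le.trans (by simp)
  · have h1 := ν.le_variation MeasurableSet.univ (P := F.image fun p => {p}) (by simp)
      (by
        intro s hs t ht hst
        simp only [Finset.coe_image, Set.mem_image] at hs ht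
        obtain ⟨p, -, rfl⟩ := hs
        obtain ⟨q, -, rfl⟩ := ht
        simp only [Function.onFun, id]
        rw [Set.disjoint_singleton]
        rintro rfl
        exact hst rfl)
    rw [Finset.sum_image (by intro a _ b _ h; simpa using h)] at h1
    have h2 := ENNReal.toReal_mono hfin h1
    rw [ENNReal.toReal_sum (by simp)] at h2
    simpa [totalMass, ENNReal.coe_toNNReal_eq_toReal] using h2

theorem truncatedRiesz_sum_dirac (s : ℝ) (F : Finset (EuclideanSpace ℝ (Fin d)))
    (c : EuclideanSpace ℝ (Fin d) → ℂ) (ε : ℝ) (x : EuclideanSpace ℝ (Fin d)) :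
    truncatedRiesz s (∑ p ∈ F, VectorMeasure.dirac p (c p)) ε x =
      ∑ p ∈ F with ε < ‖p - x‖, c p • rieszKernel d s (p - x) := by
  classical
  have hs : MeasurableSet {y : EuclideanSpace ℝ (Fin d) | ε < ‖y - x‖} :=
    measurableSet_lt measurable_const (by fun_prop)
  unfold truncatedRiesz
  have h1 : (∑ p ∈ F, (VectorMeasure.dirac p (c p) : ComplexMeasure (EuclideanSpace ℝ (Fin d)))).restrict
      {y | ε < ‖y - x‖} = ∑ p ∈ F, (VectorMeasure.dirac p (c p) : ComplexMeasure (EuclideanSpace ℝ (Fin d))).restrict {y | ε < ‖y - x‖} := by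
    have := map_sum (VectorMeasure.restrictGm (M := ℂ) {y : EuclideanSpace ℝ (Fin d) | ε < ‖y - x‖})
      (fun p => VectorMeasure.dirac p (c p)) F
    exact this
  rw [h1, VectorMeasure.integral_finsetSum_vectorMeasure]
  · rw [Finset.sum_filter]
    refine Finset.sum_congr rfl fun p _ => ?_
    rw [VectorMeasure.setIntegral_dirac hs]
    simp
  · intro p _
    refine VectorMeasure.Integrable.restrict ?_
    show Integrable _ _
    rw [VectorMeasure.variation_dirac]
    refine Integrable.smul_measure ?_ (by simp)
    exact integrable_dirac (by simp)

end PointMasses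

/-! ### Ball covers, Hausdorff content and the Vitali covering argument -/

section Covers

variable {d : ℕ}

/-- `G` is covered by countably many balls of radii at least `r` such that the sum of the `d`-th
powers of the radii is at most `A`. -/
def HasBallCover (r : ℝ≥0) (G : Set (EuclideanSpace ℝ (Fin d))) (A : ℝ≥0∞) : Prop :=
  ∃ S : Set (EuclideanSpace ℝ (Fin d) × ℝ≥0), S.Countable ∧ (∀ p ∈ S, r ≤ p.2) ∧
    G ⊆ ⋃ p ∈ S, Metric.ball p.1 (p.2 : ℝ) ∧ ∑' p : S, (p.1.2 : ℝ≥0∞) ^ d ≤ A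

theorem HasBallCover.mono {r : ℝ≥0} {G G' : Set (EuclideanSpace ℝ (Fin d))} {A A' : ℝ≥0∞}
    (h : HasBallCover r G A) (hG : G' ⊆ G) (hA : A ≤ A') : HasBallCover r G' A' := by
  obtain ⟨S, h1, h2, h3, h4⟩ := h
  exact ⟨S, h1, h2, hG.trans h3, h4.trans hA⟩

theorem HasBallCover.union {r : ℝ≥0} {G G' : Set (EuclideanSpace ℝ (Fin d))} {A A' : ℝ≥0∞}
    (h : HasBallCover r G A) (h' : HasBallCover r G' A') : HasBallCover r (G ∪ G') (A + A') := by
  obtain ⟨S, h1, h2, h3, h4⟩ := h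
  obtain ⟨T, k1, k2, k3, k4⟩ := h'
  refine ⟨S ∪ T, h1.union k1, ?_, ?_, ?_⟩
  · rintro p (hp | hp)
    exacts [h2 p hp, k2 p hp]
  · rw [biUnion_union]
    exact union_subset_union h3 k3
  · exact (ENNReal.tsum_union_le (fun p : _ × ℝ≥0 => (p.2 : ℝ≥0∞) ^ d) S T).trans (add_le_add h4 k4)

theorem hasBallCover_biUnion_finset {ι : Type*} (u : Finset ι) {r : ℝ≥0}
    (x : ι → EuclideanSpace ℝ (Fin d)) (ρ : ι → ℝ≥0) (hρ : ∀ i ∈ u, r ≤ ρ i) :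
    HasBallCover r (⋃ i ∈ u, Metric.ball (x i) (ρ i : ℝ)) (∑ i ∈ u, (ρ i : ℝ≥0∞) ^ d) := by
  classical
  refine ⟨(u.image fun i => (x i, ρ i) : Finset _), Finset.countable_toSet _, ?_, ?_, ?_⟩
  · intro p hp
    simp only [Finset.coe_image, Set.mem_image] at hp
    obtain ⟨i, hi, rfl⟩ := hp
    exact hρ i hi
  · intro z hz
    simp only [mem_iUnion] at hz ⊢
    obtain ⟨i, hi, hz⟩ := hz
    exact ⟨(x i, ρ i), by simpa using ⟨i, hi, rfl, rfl⟩, hz⟩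
  · rw [Finset.tsum_subtype' _ (fun p : EuclideanSpace ℝ (Fin d) × ℝ≥0 => (p.2 : ℝ≥0∞) ^ d)]
    exact Finset.sum_image_le_of_nonneg (fun _ _ => by simp)

theorem IsMeasuringFunction.map_mul_pow_le {h : ℝ≥0 → ℝ≥0} (hh : IsMeasuringFunction d h)
    {r ρ : ℝ≥0} (hr : 0 < r) (hρ : r ≤ ρ) : h ρ * r ^ d ≤ h r * ρ ^ d := by
  have h1 := hh.antitoneOn_div (show r ∈ Ioi 0 from hr) (show ρ ∈ Ioi 0 from hr.trans_le hρ) hρ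
  simp only at h1
  rwa [div_le_div_iff₀ (pow_pos (hr.trans_le hρ) d) (pow_pos hr d)] at h1

/-- All radii are at least `r`, so each `h ρ` is at most `ρ ^ d * (h r / r ^ d)`. A bound for the
sum of the `d`-th powers thus serves all measuring functions at once. -/
theorem HasBallCover.hausdorffContent_le {h : ℝ≥0 → ℝ≥0} (hh : IsMeasuringFunction d h) {r : ℝ≥0}
    (hr : 0 < r) {G : Set (EuclideanSpace ℝ (Fin d))} {A : ℝ≥0∞} (hG : HasBallCover r G A) :
    hausdorffContent h G ≤ A * (h r / r ^ d : ℝ≥0) := by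
  classical
  obtain ⟨S, h1, h2, h3, h4⟩ := hG
  have := h1.to_subtype
  obtain ⟨f, hf⟩ := exists_injective_nat S
  -- Unused indices receive radius 0; they cost nothing because `h 0 = 0`.
  set X : ℕ → EuclideanSpace ℝ (Fin d) := Function.extend f (fun p => p.1.1) 0
  set R : ℕ → ℝ≥0 := Function.extend f (fun p => p.1.2) 0
  have hcov : G ⊆ ⋃ j, Metric.ball (X j) (R j : ℝ) := by
    intro z hz
    obtain ⟨p, hp, hzp⟩ := mem_iUnion₂.1 (h3 hz)
    refine mem_iUnion.2 ⟨f ⟨p, hp⟩, ?_⟩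
    simpa [X, R, hf.extend_apply] using hzp
  have h0 : hausdorffContent h G ≤ ∑' j, (h (R j) : ℝ≥0∞) :=
    iInf_le_of_le X (iInf_le_of_le R (iInf_le_of_le hcov le_rfl))
  refine h0.trans ?_
  have h5 : (fun j => (h (R j) : ℝ≥0∞)) = Function.extend f (fun p => (h p.1.2 : ℝ≥0∞)) 0 := by
    funext j
    by_cases hj : ∃ p, f p = j
    · obtain ⟨p, rfl⟩ := hj
      simp [R, hf.extend_apply]
    · simp [R, Function.extend_apply' _ _ _ hj, hh.map_zero]
  rw [h5, tsum_extend_zero hf]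
  calc ∑' p : S, (h p.1.2 : ℝ≥0∞) ≤ ∑' p : S, ((p.1.2 : ℝ≥0∞) ^ d * (h r / r ^ d : ℝ≥0)) := by
        refine ENNReal.tsum_le_tsum fun p => ?_
        have h6 := hh.map_mul_pow_le hr (h2 p.1 p.2)
        have h7 : h p.1.2 ≤ p.1.2 ^ d * (h r / r ^ d) := by
          rw [mul_div_assoc', le_div_iff₀ (pow_pos hr d), mul_comm (p.1.2 ^ d)]
          exact h6
        exact_mod_cast h7
    _ = (∑' p : S, (p.1.2 : ℝ≥0∞) ^ d) * (h r / r ^ d : ℝ≥0) := ENNReal.tsum_mul_right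
    _ ≤ _ := by gcongr

/-- The weak type `(1, 1)` inequality for a maximal function with averages over balls of radius at
least `r`. -/
theorem hasBallCover_maximal {r : ℝ≥0} (hr : 0 < r) (hd : d ≠ 0) {lam : ℝ≥0} (hlam : 0 < lam)
    (f : EuclideanSpace ℝ (Fin d) → ℝ≥0∞) (hfin : ∫⁻ z, f z ≠ ∞) :
    HasBallCover r
      {x | ∃ ε : ℝ≥0, r ≤ ε ∧ (lam * ε ^ d : ℝ≥0) < ∫⁻ z in Metric.closedBall x ε, f z}
      (6 ^ d / lam * ∫⁻ z, f z) := by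
  classical
  set V : Set (EuclideanSpace ℝ (Fin d)) :=
    {x | ∃ ε : ℝ≥0, r ≤ ε ∧ (lam * ε ^ d : ℝ≥0) < ∫⁻ z in Metric.closedBall x ε, f z} with hV
  have hch : ∀ x, ∃ ε : ℝ≥0, x ∈ V →
      r ≤ ε ∧ (lam * ε ^ d : ℝ≥0) < ∫⁻ z in Metric.closedBall x ε, f z := by
    intro x
    by_cases hx : x ∈ V
    · obtain ⟨ε, h⟩ := hx
      exact ⟨ε, fun _ => h⟩
    · exact ⟨0, fun h => absurd h hx⟩
  choose ε hε using hch
  -- Vitali's lemma needs bounded radii: `lam * ε ^ d ≤ ∫ f`, and `ε ≤ ε ^ d` as soon as `ε ≥ 1`.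
  have hbd : ∀ x ∈ V, (ε x : ℝ) ≤ (max 1 ((∫⁻ z, f z).toNNReal / lam) : ℝ≥0) := by
    intro x hx
    have h1 := (hε x hx).2.le.trans (setLIntegral_le_lintegral _ _)
    rw [← ENNReal.coe_toNNReal hfin, ENNReal.coe_le_coe] at h1
    rw [NNReal.coe_le_coe]
    rcases le_total (ε x) 1 with h2 | h2
    · exact h2.trans (le_max_left _ _)
    · refine le_trans ?_ (le_max_right _ _)
      rw [le_div_iff₀ hlam, mul_comm]
      exact le_trans (by gcongr; exact le_self_pow₀ h2 hd) h1
  obtain ⟨u, huV, hdisj, hcov⟩ := Vitali.exists_disjoint_subfamily_covering_enlargement_closedBall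
    V id (fun x => (ε x : ℝ)) _ hbd 5 (by norm_num)
  simp only [id] at hdisj hcov
  have hpos : ∀ x ∈ u, 0 < ε x := fun x hx => hr.trans_le (hε x (huV hx)).1
  have hucount : u.Countable := by
    refine hdisj.countable_of_nonempty_interior fun x hx => ?_
    exact (Metric.nonempty_ball.2 (hpos x hx)).mono
      (interior_maximal Metric.ball_subset_closedBall Metric.isOpen_ball)
  have := hucount.to_subtype
  -- Vitali gives closed balls of radius `5 * ε`; the factor 6 passes to open balls.
  refine ⟨(fun x => (x, 6 * ε x)) '' u, hucount.image _, ?_, ?_, ?_⟩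
  · rintro _ ⟨x, hx, rfl⟩
    refine (hε x (huV hx)).1.trans ?_
    exact le_mul_of_one_le_left zero_le (by norm_num)
  · intro x hx
    obtain ⟨b, hb, hsub⟩ := hcov x hx
    refine mem_iUnion₂.2 ⟨_, mem_image_of_mem _ hb, ?_⟩
    have h1 := hsub (Metric.mem_closedBall_self (NNReal.coe_nonneg _))
    rw [Metric.mem_closedBall] at h1
    rw [Metric.mem_ball]
    have h2 : (0 : ℝ) < ε b := hpos b hb
    push_cast
    linarith
  · have hinj : InjOn (fun x : EuclideanSpace ℝ (Fin d) => (x, 6 * ε x)) u := by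
      intro a _ b _ hab
      exact congrArg Prod.fst hab
    rw [tsum_image (fun p : EuclideanSpace ℝ (Fin d) × ℝ≥0 => (p.2 : ℝ≥0∞) ^ d) hinj]
    have h1 : ∑' x : u, ∫⁻ z in Metric.closedBall x.1 (ε x.1 : ℝ), f z ≤ ∫⁻ z, f z := by
      have h2 := lintegral_iUnion (μ := volume)
        (s := fun x : u => Metric.closedBall x.1 (ε x.1 : ℝ))
        (fun x => measurableSet_closedBall)
        (fun a b hab => hdisj a.2 b.2 (fun h => hab (Subtype.ext h))) f
      rw [← h2]
      exact setLIntegral_le_lintegral _ _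
    calc ∑' x : u, ((6 * ε x.1 : ℝ≥0) : ℝ≥0∞) ^ d
        ≤ ∑' x : u, (6 ^ d / lam * ∫⁻ z in Metric.closedBall x.1 (ε x.1 : ℝ), f z) := by
          refine ENNReal.tsum_le_tsum fun x => ?_
          have h3 := (hε x.1 (huV x.2)).2.le
          calc ((6 * ε x.1 : ℝ≥0) : ℝ≥0∞) ^ d
              = 6 ^ d / lam * (lam * ε x.1 ^ d : ℝ≥0) := by
                push_cast
                rw [← mul_assoc, ENNReal.div_mul_cancel (by simpa using hlam.ne') (by simp),
                  mul_pow]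
            _ ≤ _ := by gcongr
      _ = 6 ^ d / lam * ∑' x : u, ∫⁻ z in Metric.closedBall x.1 (ε x.1 : ℝ), f z :=
          ENNReal.tsum_mul_left
      _ ≤ _ := by gcongr

end Covers

/-! ### The Riesz and Poisson kernels in the upper half space -/

section Kernels

variable {E : Type*} [NormedAddCommGroup E]

/-- The norm of the point `(x, t)` of `E × ℝ`. -/
noncomputable def upperNorm (t : ℝ) (x : E) : ℝ := √(‖x‖ ^ 2 + t ^ 2)

/-- The component along `E` of the vector `X / |X| ^ n`, where `X = (x, t)`. -/
noncomputable def upperRiesz [NormedSpace ℝ E] (n : ℕ) (t : ℝ) (x : E) : E := (upperNorm t x ^ n)⁻¹ • x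

/-- The last component of the vector `X / |X| ^ n`, where `X = (x, t)`. For `n = dim E + 1` this is
a multiple of the Poisson kernel. -/
noncomputable def upperPoisson (n : ℕ) (t : ℝ) (x : E) : ℝ := t / upperNorm t x ^ n

theorem upperNorm_nonneg (t : ℝ) (x : E) : 0 ≤ upperNorm t x := Real.sqrt_nonneg _

theorem upperNorm_sq (t : ℝ) (x : E) : upperNorm t x ^ 2 = ‖x‖ ^ 2 + t ^ 2 :=
  Real.sq_sqrt (by positivity)

theorem norm_le_upperNorm (t : ℝ) (x : E) : ‖x‖ ≤ upperNorm t x :=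
  Real.le_sqrt_of_sq_le (by nlinarith [sq_nonneg t])

theorem abs_le_upperNorm (t : ℝ) (x : E) : |t| ≤ upperNorm t x :=
  Real.le_sqrt_of_sq_le (by nlinarith [sq_nonneg ‖x‖, sq_abs t])

theorem le_upperNorm (t : ℝ) (x : E) : t ≤ upperNorm t x := (le_abs_self t).trans (abs_le_upperNorm t x)

theorem upperNorm_pos {t : ℝ} (ht : 0 < t) (x : E) : 0 < upperNorm t x :=
  ht.trans_le (le_upperNorm t x)

theorem upperNorm_zero_left (x : E) : upperNorm 0 x = ‖x‖ := by
  simp [upperNorm]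

theorem upperNorm_neg (t : ℝ) (x : E) : upperNorm t (-x) = upperNorm t x := by
  simp [upperNorm]

theorem upperNorm_mono_left {t t' : ℝ} (ht : 0 ≤ t) (h : t ≤ t') (x : E) :
    upperNorm t x ≤ upperNorm t' x := by
  unfold upperNorm
  gcongr

theorem upperNorm_le_add {t : ℝ} (ht : 0 ≤ t) (x : E) : upperNorm t x ≤ t + ‖x‖ :=
  Real.sqrt_le_iff.2 ⟨by positivity, by nlinarith [norm_nonneg x, mul_nonneg ht (norm_nonneg x)]⟩

theorem add_le_two_mul_upperNorm (t : ℝ) (x : E) : t + ‖x‖ ≤ 2 * upperNorm t x := by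
  linarith [norm_le_upperNorm t x, le_upperNorm t x]

theorem upperNorm_le_upperNorm_add (t t' : ℝ) (x x' : E) :
    upperNorm t x ≤ upperNorm t' x' + (‖x - x'‖ + |t - t'|) := by
  have h1 : ‖x‖ ≤ ‖x'‖ + ‖x - x'‖ := by
    simpa using norm_add_le x' (x - x')
  have h2 : |t| ≤ |t'| + |t - t'| := by
    simpa using abs_add_le t' (t - t')
  have h3 := norm_le_upperNorm t' x'
  have h4 := abs_le_upperNorm t' x'
  have h5 := upperNorm_sq t' x'
  have h6 := upperNorm_nonneg t' x'
  refine Real.sqrt_le_iff.2 ⟨by positivity, ?_⟩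
  have h7 : ‖x‖ ^ 2 ≤ (‖x'‖ + ‖x - x'‖) ^ 2 := by gcongr
  have h8 : t ^ 2 ≤ (|t'| + |t - t'|) ^ 2 := by
    rw [← sq_abs t]
    gcongr
  have h9 := mul_le_mul_of_nonneg_right h3 (norm_nonneg (x - x'))
  have h10 := mul_le_mul_of_nonneg_right h4 (abs_nonneg (t - t'))
  have h11 := mul_nonneg (norm_nonneg (x - x')) (abs_nonneg (t - t'))
  nlinarith [sq_abs t']

/-- The mean value inequality for powers, multiplied by `b` to avoid the exponent `n - 1`. -/
theorem mul_pow_sub_pow_le {a b : ℝ} (ha : 0 ≤ a) (hab : a ≤ b) (n : ℕ) :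
    b * (b ^ n - a ^ n) ≤ n * (b - a) * b ^ n := by
  induction n with
  | zero => simp
  | succ n ih =>
    have hb := ha.trans hab
    have h1 : a ^ n ≤ b ^ n := by gcongr
    have h2 := mul_le_mul_of_nonneg_left ih hb
    have h3 := mul_le_mul_of_nonneg_left h1 (mul_nonneg hb (sub_nonneg.2 hab))
    push_cast
    rw [pow_succ, pow_succ]
    nlinarith

/-- The vector fields `X / |X| ^ n` are Lipschitz away from the origin. -/
theorem norm_upperRiesz_sub_le [NormedSpace ℝ E] (n : ℕ) {l : ℝ} (hl : 0 < l) {t t' : ℝ} {x x' : E}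
    (h : l ≤ upperNorm t x) (h' : l ≤ upperNorm t' x') :
    ‖upperRiesz n t x - upperRiesz n t' x'‖ ≤ (n + 1) * (‖x - x'‖ + |t - t'|) / l ^ n := by
  wlog hle : upperNorm t x ≤ upperNorm t' x' generalizing t t' x x'
  · rw [norm_sub_rev, norm_sub_rev x, abs_sub_comm]
    exact this h' h (le_of_not_ge hle)
  have hlip := upperNorm_le_upperNorm_add t' t x' x
  rw [norm_sub_rev, abs_sub_comm] at hlip
  have hx' := norm_le_upperNorm t' x'
  unfold upperRiesz
  set a := upperNorm t x
  set b := upperNorm t' x'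
  set D := ‖x - x'‖ + |t - t'|
  have ha : 0 < a := hl.trans_le h
  have hb : 0 < b := hl.trans_le h'
  have hD : ‖x - x'‖ ≤ D := le_add_of_nonneg_right (abs_nonneg _)
  have hD0 : 0 ≤ D := (norm_nonneg _).trans hD
  -- The difference of the coefficients falls on `x'`, whose norm is at most the larger number `b`;
  -- this is the factor `b` in `mul_pow_sub_pow_le`.
  have hsplit : (a ^ n)⁻¹ • x - (b ^ n)⁻¹ • x' =
      (a ^ n)⁻¹ • (x - x') + ((a ^ n)⁻¹ - (b ^ n)⁻¹) • x' := by
    rw [smul_sub, sub_smul]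
    abel
  have hab : a ^ n ≤ b ^ n := by gcongr
  have hinv : 0 ≤ (a ^ n)⁻¹ - (b ^ n)⁻¹ := sub_nonneg.2 (by gcongr)
  have h1 : ((a ^ n)⁻¹ - (b ^ n)⁻¹) * b ≤ n * D * (a ^ n)⁻¹ := by
    have h2 := mul_pow_sub_pow_le ha.le hle n
    have h3 : ((a ^ n)⁻¹ - (b ^ n)⁻¹) * b = b * (b ^ n - a ^ n) * ((a ^ n)⁻¹ * (b ^ n)⁻¹) := by
      field_simp
    rw [h3]
    calc b * (b ^ n - a ^ n) * ((a ^ n)⁻¹ * (b ^ n)⁻¹)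
        ≤ (n * (b - a) * b ^ n) * ((a ^ n)⁻¹ * (b ^ n)⁻¹) := by gcongr
      _ = n * (b - a) * (a ^ n)⁻¹ := by field_simp
      _ ≤ n * D * (a ^ n)⁻¹ := by gcongr; linarith
  rw [hsplit]
  calc ‖(a ^ n)⁻¹ • (x - x') + ((a ^ n)⁻¹ - (b ^ n)⁻¹) • x'‖
      ≤ (a ^ n)⁻¹ * ‖x - x'‖ + ((a ^ n)⁻¹ - (b ^ n)⁻¹) * ‖x'‖ := by
        refine (norm_add_le _ _).trans ?_
        rw [norm_smul, norm_smul, Real.norm_of_nonneg hinv, Real.norm_of_nonneg (by positivity)]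
    _ ≤ (a ^ n)⁻¹ * D + n * D * (a ^ n)⁻¹ :=
        add_le_add (by gcongr) ((mul_le_mul_of_nonneg_left hx' hinv).trans h1)
    _ = (n + 1) * D / a ^ n := by ring
    _ ≤ _ := by gcongr

theorem norm_upperRiesz_le [NormedSpace ℝ E] (d : ℕ) (t : ℝ) (x : E) :
    ‖upperRiesz (d + 1) t x‖ ≤ (upperNorm t x ^ d)⁻¹ := by
  unfold upperRiesz
  have h0 := upperNorm_nonneg t x
  rw [norm_smul, Real.norm_of_nonneg (by positivity)]
  rcases h0.eq_or_lt with h | h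
  · have : ‖x‖ = 0 := le_antisymm (h ▸ norm_le_upperNorm t x) (norm_nonneg x)
    rw [this]
    simp [← h]
  · calc (upperNorm t x ^ (d + 1))⁻¹ * ‖x‖ ≤ (upperNorm t x ^ (d + 1))⁻¹ * upperNorm t x := by
          gcongr; exact norm_le_upperNorm t x
      _ = _ := by rw [pow_succ]; field_simp

theorem upperPoisson_nonneg (n : ℕ) {t : ℝ} (ht : 0 ≤ t) (x : E) : 0 ≤ upperPoisson n t x :=
  div_nonneg ht (pow_nonneg (upperNorm_nonneg t x) n)

theorem abs_upperPoisson_le (d : ℕ) (t : ℝ) (x : E) :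
    |upperPoisson (d + 1) t x| ≤ (upperNorm t x ^ d)⁻¹ := by
  unfold upperPoisson
  have h0 := upperNorm_nonneg t x
  rw [abs_div, abs_of_nonneg (pow_nonneg h0 _)]
  rcases h0.eq_or_lt with h | h
  · simp [← h]
  · rw [div_le_iff₀ (by positivity), pow_succ]
    field_simp
    exact abs_le_upperNorm t x

theorem continuous_upperNorm (t : ℝ) : Continuous (fun x : E => upperNorm t x) := by
  unfold upperNorm
  fun_prop

theorem continuous_upperPoisson (n : ℕ) {t : ℝ} (ht : 0 < t) :
    Continuous (fun x : E => upperPoisson n t x) :=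
  continuous_const.div ((continuous_upperNorm t).pow n) fun x => (pow_pos (upperNorm_pos ht x) n).ne'

theorem continuous_upperRiesz [NormedSpace ℝ E] (n : ℕ) {t : ℝ} (ht : 0 < t) :
    Continuous (fun x : E => upperRiesz n t x) :=
  (((continuous_upperNorm t).pow n).inv₀ fun x => (pow_pos (upperNorm_pos ht x) n).ne').smul
    continuous_id

/-- A Harnack inequality at the scale of the height. -/
theorem upperPoisson_le_of_norm_sub_le (n : ℕ) {t : ℝ} (ht : 0 < t) {x x' : E}
    (h : ‖x - x'‖ ≤ t) : upperPoisson n t x ≤ 2 ^ n * upperPoisson n t x' := by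
  have h1 : upperNorm t x' ≤ 2 * upperNorm t x := by
    have := upperNorm_le_upperNorm_add t t x' x
    rw [norm_sub_rev, sub_self, abs_zero] at this
    linarith [le_upperNorm t x]
  unfold upperPoisson
  have h2 := upperNorm_pos ht x
  have h3 := upperNorm_pos ht x'
  rw [mul_div_assoc', div_le_div_iff₀ (by positivity) (by positivity)]
  calc t * upperNorm t x' ^ n ≤ t * (2 * upperNorm t x) ^ n := by gcongr
    _ = _ := by ring

/-- If `x = a - b` is a difference of two vectors, a product of Poisson kernels is controlled by
the Poisson kernel of `x` at the larger height. -/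
theorem upperPoisson_mul_le (n : ℕ) {t t' : ℝ} (ht' : 0 < t') (h : t' ≤ t) (a b : E) :
    upperPoisson n t a * upperPoisson n t' b ≤
      4 ^ n * upperPoisson n t (a - b) * (upperPoisson n t a + upperPoisson n t' b) := by
  have ht := ht'.trans_le h
  have ha := upperPoisson_nonneg n ht.le a
  have hb := upperPoisson_nonneg n ht'.le b
  have key : ∀ {τ : ℝ}, 0 < τ → τ ≤ t → ∀ v : E, upperNorm t (a - b) ≤ 4 * upperNorm τ v →
      upperPoisson n τ v ≤ 4 ^ n * upperPoisson n t (a - b) := by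
    intro τ hτ hτt v hv
    have h2 := upperNorm_pos hτ v
    have h3 := upperNorm_pos ht (a - b)
    unfold upperPoisson
    rw [mul_div_assoc', div_le_div_iff₀ (by positivity) (by positivity)]
    calc τ * upperNorm t (a - b) ^ n ≤ t * (4 * upperNorm τ v) ^ n := by gcongr
      _ = _ := by ring
  have hab := norm_sub_le a b
  have h1 := upperNorm_le_add ht.le (a - b)
  -- One of the two points has norm at least a quarter of that of `(a - b, t)`. If it is not `(a,
  -- t)`, the triangle inequality makes `‖b‖` large. The corresponding factor is absorbed by the
  -- Poisson kernel of `a - b`, and the other one remains.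
  by_cases hc : upperNorm t (a - b) ≤ 4 * upperNorm t a
  · have := key ht le_rfl a hc
    nlinarith [mul_le_mul_of_nonneg_right this hb, upperPoisson_nonneg n ht.le (a - b),
      mul_nonneg (mul_nonneg (pow_nonneg (by norm_num : (0 : ℝ) ≤ 4) n)
        (upperPoisson_nonneg n ht.le (a - b))) ha]
  · have : upperPoisson n t' b ≤ 4 ^ n * upperPoisson n t (a - b) := by
      refine key ht' h b ?_
      linarith [le_upperNorm t a, norm_le_upperNorm t a, norm_le_upperNorm t' b]
    nlinarith [mul_le_mul_of_nonneg_right this ha, upperPoisson_nonneg n ht.le (a - b),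
      mul_nonneg (mul_nonneg (pow_nonneg (by norm_num : (0 : ℝ) ≤ 4) n)
        (upperPoisson_nonneg n ht.le (a - b))) hb]

end Kernels

/-! ### Integrals of the kernels -/

section Integrals

variable {d : ℕ}

/-- Translation and dilation by `t` reduce to `t = 1`, where the integral converges because `s > d`.
-/
theorem exists_integral_add_norm_rpow {s : ℝ} (hs : (d : ℝ) < s) :
    ∃ C : ℝ, 0 ≤ C ∧ ∀ (t : ℝ), 0 < t → ∀ y : EuclideanSpace ℝ (Fin d),
      Integrable (fun x : EuclideanSpace ℝ (Fin d) => (t + ‖x - y‖) ^ (-s)) ∧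
        ∫ x : EuclideanSpace ℝ (Fin d), (t + ‖x - y‖) ^ (-s) = C * t ^ ((d : ℝ) - s) := by
  refine ⟨∫ x : EuclideanSpace ℝ (Fin d), (1 + ‖x‖) ^ (-s), integral_nonneg fun x => by positivity, fun t ht y => ?_⟩
  have h1 : Integrable (fun x : EuclideanSpace ℝ (Fin d) => (1 + ‖x‖) ^ (-s)) := integrable_one_add_norm (by simpa using hs)
  have h2 : (fun x : EuclideanSpace ℝ (Fin d) => (t + ‖x‖) ^ (-s)) = fun x => t ^ (-s) * (1 + ‖t⁻¹ • x‖) ^ (-s) := by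
    funext x
    rw [← Real.mul_rpow ht.le (by positivity), norm_smul, Real.norm_of_nonneg (by positivity)]
    congr 1
    field_simp
  constructor
  · refine Integrable.comp_sub_right (f := fun x : EuclideanSpace ℝ (Fin d) => (t + ‖x‖) ^ (-s)) ?_ y
    rw [h2]
    exact (h1.comp_smul (inv_pos.2 ht).ne').const_mul _
  · rw [integral_sub_right_eq_self (fun x : EuclideanSpace ℝ (Fin d) => (t + ‖x‖) ^ (-s)) y, h2, integral_const_mul,
      Measure.integral_comp_smul volume (fun x : EuclideanSpace ℝ (Fin d) => (1 + ‖x‖) ^ (-s))]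
    have h3 : |((t⁻¹ : ℝ) ^ Module.finrank ℝ (EuclideanSpace ℝ (Fin d)))⁻¹| = t ^ (d : ℝ) := by
      rw [finrank_euclideanSpace_fin, inv_pow, inv_inv, abs_of_pos (by positivity), Real.rpow_natCast]
    rw [h3, smul_eq_mul, ← mul_assoc, ← Real.rpow_add ht, mul_comm]
    congr 2
    ring

theorem integrable_upperNorm_pow_inv {n : ℕ} (hn : d < n) {t : ℝ} (ht : 0 < t) (y : EuclideanSpace ℝ (Fin d)) :
    Integrable (fun x : EuclideanSpace ℝ (Fin d) => (upperNorm t (x - y) ^ n)⁻¹) := by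
  obtain ⟨C, -, h⟩ := exists_integral_add_norm_rpow (d := d) (s := n) (by exact_mod_cast hn)
  refine ((h t ht y).1.const_mul (2 ^ n)).mono' ?_ (ae_of_all _ fun x => ?_)
  · refine Continuous.aestronglyMeasurable ?_
    refine (((continuous_upperNorm t).comp (continuous_sub_right y)).pow n).inv₀ fun x => ?_
    exact (pow_pos (upperNorm_pos ht _) n).ne'
  · have h1 := upperNorm_pos ht (x - y)
    rw [Real.norm_of_nonneg (by positivity), Real.rpow_neg (by positivity), Real.rpow_natCast,
      ← div_eq_mul_inv, inv_eq_one_div, div_le_div_iff₀ (by positivity) (by positivity), one_mul,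
      ← mul_pow]
    gcongr
    exact add_le_two_mul_upperNorm t (x - y)

theorem integrable_upperPoisson {t : ℝ} (ht : 0 < t) (y : EuclideanSpace ℝ (Fin d)) :
    Integrable (fun x : EuclideanSpace ℝ (Fin d) => upperPoisson (d + 1) t (x - y)) := by
  simp only [upperPoisson, div_eq_mul_inv]
  exact (integrable_upperNorm_pow_inv (by simp) ht y).const_mul t

theorem exists_integral_upperPoisson_le (d : ℕ) :
    ∃ C : ℝ, 0 ≤ C ∧ ∀ (t : ℝ), 0 < t → ∀ y : EuclideanSpace ℝ (Fin d),
      ∫ x : EuclideanSpace ℝ (Fin d), upperPoisson (d + 1) t (x - y) ≤ C := by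
  obtain ⟨C, hC, h⟩ := exists_integral_add_norm_rpow (d := d) (s := (d + 1 : ℕ)) (by simp)
  refine ⟨2 ^ (d + 1) * C, by positivity, fun t ht y => ?_⟩
  calc ∫ x : EuclideanSpace ℝ (Fin d), upperPoisson (d + 1) t (x - y)
      ≤ ∫ x : EuclideanSpace ℝ (Fin d), (t * 2 ^ (d + 1)) * (t + ‖x - y‖) ^ (-((d + 1 : ℕ) : ℝ)) := by
        refine integral_mono (integrable_upperPoisson ht y) ((h t ht y).1.const_mul _) fun x => ?_
        have h1 := upperNorm_pos ht (x - y)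
        rw [upperPoisson, Real.rpow_neg (by positivity), Real.rpow_natCast, ← div_eq_mul_inv,
          div_le_div_iff₀ (by positivity) (by positivity), mul_assoc, ← mul_pow]
        gcongr
        exact add_le_two_mul_upperNorm t (x - y)
    _ = 2 ^ (d + 1) * C := by
        rw [integral_const_mul, (h t ht y).2]
        have : (t : ℝ) ^ ((d : ℝ) - ((d + 1 : ℕ) : ℝ)) = t⁻¹ := by
          rw [← Real.rpow_neg_one]
          congr 1
          push_cast
          ring
        rw [this]
        field_simp

end Integrals

/-! ### Derivatives and size of the powers of the upper norm -/

section Weights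

variable {E : Type*} [NormedAddCommGroup E]

/-- The function `|X| ^ (-n)` of the point `X = (x, t)`. -/
noncomputable def upperWeight (n : ℕ) (t : ℝ) (x : E) : ℝ := (upperNorm t x ^ n)⁻¹

theorem upperWeight_pos (n : ℕ) {t : ℝ} (ht : 0 < t) (x : E) : 0 < upperWeight n t x :=
  inv_pos.2 (pow_pos (upperNorm_pos ht x) n)

theorem continuous_upperWeight (n : ℕ) {t : ℝ} (ht : 0 < t) :
    Continuous (fun x : E => upperWeight n t x) :=
  ((continuous_upperNorm t).pow n).inv₀ fun x => (pow_pos (upperNorm_pos ht x) n).ne'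

theorem upperWeight_anti {t t' : ℝ} (n : ℕ) (ht : 0 < t) (h : t ≤ t') (x : E) :
    upperWeight n t' x ≤ upperWeight n t x := by
  have h1 := upperNorm_pos ht x
  have h2 := upperNorm_mono_left ht.le h x
  unfold upperWeight
  gcongr

theorem upperWeight_add_two {t : ℝ} (n : ℕ) (ht : 0 < t) (x : E) :
    upperWeight (n + 2) t x * (‖x‖ ^ 2 + t ^ 2) = upperWeight n t x := by
  have h1 := upperNorm_pos ht x
  rw [← upperNorm_sq, upperWeight, upperWeight, pow_add]
  field_simp

theorem upperWeight_succ_le {t : ℝ} (n : ℕ) (ht : 0 < t) (x : E) :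
    upperWeight (n + 1) t x ≤ t⁻¹ * upperWeight n t x := by
  have h1 := upperNorm_pos ht x
  rw [upperWeight, upperWeight, pow_succ, mul_inv, mul_comm]
  gcongr
  exact le_upperNorm t x

theorem abs_mul_upperWeight_succ_le {t : ℝ} (n : ℕ) (ht : 0 < t) (x : E) {α : ℝ}
    (hα : |α| ≤ upperNorm t x) : |α * upperWeight (n + 1) t x| ≤ upperWeight n t x := by
  have h1 := upperNorm_pos ht x
  rw [abs_mul, abs_of_pos (upperWeight_pos _ ht x)]
  calc |α| * upperWeight (n + 1) t x ≤ upperNorm t x * upperWeight (n + 1) t x := by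
        have := upperWeight_pos (n + 1) ht x
        gcongr
    _ = upperWeight n t x := by
        rw [upperWeight, upperWeight, pow_succ]
        field_simp

theorem hasDerivAt_sqrt_pow_inv (n : ℕ) {u : ℝ} (hu : 0 < u) :
    HasDerivAt (fun u : ℝ => (√u ^ n)⁻¹) (-(n / 2) * (√u ^ (n + 2))⁻¹) u := by
  have h0 : 0 < √u := Real.sqrt_pos.2 hu
  have h1 := ((Real.hasDerivAt_sqrt hu.ne').pow n).inv (pow_pos h0 n).ne'
  refine h1.congr_deriv ?_
  rcases n with _ | n
  · simp
  · simp only [Nat.add_sub_cancel, Pi.pow_apply]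
    field_simp
    ring

theorem hasDerivAt_upperWeight (n : ℕ) {t : ℝ} (ht : 0 < t) (x : E) :
    HasDerivAt (fun t => upperWeight n t x) (-n * t * upperWeight (n + 2) t x) t := by
  have h1 : HasDerivAt (fun t : ℝ => ‖x‖ ^ 2 + t ^ 2) (2 * t) t := by
    simpa using (hasDerivAt_pow 2 t).const_add (‖x‖ ^ 2)
  have h2 := (hasDerivAt_sqrt_pow_inv n (u := ‖x‖ ^ 2 + t ^ 2) (by positivity)).comp t h1
  refine h2.congr_deriv ?_
  rw [upperWeight, upperNorm]
  ring

variable [InnerProductSpace ℝ E]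

theorem hasLineDerivAt_upperWeight (n : ℕ) {t : ℝ} (ht : 0 < t) (x y v : E) :
    HasLineDerivAt ℝ (fun x => upperWeight n t (x - y))
      (-n * inner ℝ (x - y) v * upperWeight (n + 2) t (x - y)) x v := by
  have h1 : HasDerivAt (fun σ : ℝ => ‖x + σ • v - y‖ ^ 2 + t ^ 2) (2 * inner ℝ (x - y) v) 0 := by
    have h2 : HasDerivAt (fun σ : ℝ => x + σ • v - y) v 0 := by
      simpa using (((hasDerivAt_id (0 : ℝ)).smul_const v).const_add x).sub_const y
    simpa using h2.norm_sq.add_const (t ^ 2)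
  have h2 := (hasDerivAt_sqrt_pow_inv n (u := ‖x + (0 : ℝ) • v - y‖ ^ 2 + t ^ 2)
    (by positivity)).comp (0 : ℝ) h1
  refine h2.congr_deriv ?_
  rw [upperWeight, upperNorm, zero_smul, add_zero]
  ring

end Weights

/-! ### The Rellich identity for two poles -/

section RellichIdentity

variable {d : ℕ}

/-- The product is at most the sum of the squares, which decay like $|x|^{-2d}$, and $2d>d$. It is
the common majorant for the integrals of this part. -/
theorem integrable_upperWeight_mul (hd : d ≠ 0) {t t' : ℝ} (ht : 0 < t) (ht' : 0 < t')
    (y z : EuclideanSpace ℝ (Fin d)) :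
    Integrable (fun x => upperWeight d t (x - y) * upperWeight d t' (x - z)) := by
  have hdd : d < d + d := by omega
  refine ((integrable_upperNorm_pow_inv hdd ht y).add
    (integrable_upperNorm_pow_inv hdd ht' z)).mono' ?_ (ae_of_all _ fun x => ?_)
  · exact (((continuous_upperWeight d ht).comp (continuous_sub_right y)).mul
      ((continuous_upperWeight d ht').comp (continuous_sub_right z))).aestronglyMeasurable
  · have h1 := upperWeight_pos d ht (x - y)
    have h2 := upperWeight_pos d ht' (x - z)
    rw [Real.norm_of_nonneg (by positivity)]
    simp only [Pi.add_apply, pow_add, mul_inv]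
    change _ ≤ upperWeight d t (x - y) * upperWeight d t (x - y) +
      upperWeight d t' (x - z) * upperWeight d t' (x - z)
    nlinarith [sq_nonneg (upperWeight d t (x - y) - upperWeight d t' (x - z))]

theorem integrable_of_abs_le_upperWeight_mul (hd : d ≠ 0) {t t' : ℝ} (ht : 0 < t) (ht' : 0 < t')
    (y z : EuclideanSpace ℝ (Fin d)) {F : EuclideanSpace ℝ (Fin d) → ℝ} (hF : Continuous F) (C : ℝ)
    (h : ∀ x, |F x| ≤ C * (upperWeight d t (x - y) * upperWeight d t' (x - z))) : Integrable F :=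
  ((integrable_upperWeight_mul hd ht ht' y z).const_mul C).mono' hF.aestronglyMeasurable
    (ae_of_all _ h)

theorem abs_mul_le_upperWeight_mul {t t' : ℝ} (ht : 0 < t)
    {a b : EuclideanSpace ℝ (Fin d)} {α β A B : ℝ}
    (hA : 0 ≤ A) (hα : |α| ≤ A * upperWeight d t a) (hβ : |β| ≤ B * upperWeight d t' b) :
    |α * β| ≤ A * B * (upperWeight d t a * upperWeight d t' b) := by
  rw [abs_mul]
  calc |α| * |β| ≤ (A * upperWeight d t a) * (B * upperWeight d t' b) := by
        have := upperWeight_pos d ht a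
        gcongr
    _ = _ := by ring

theorem abs_height_mul_upperWeight_le {t : ℝ} (ht : 0 < t) (a : EuclideanSpace ℝ (Fin d)) :
    |t * upperWeight (d + 1) t a| ≤ 1 * upperWeight d t a := by
  rw [one_mul]
  exact abs_mul_upperWeight_succ_le d ht a (abs_le_upperNorm t a)

theorem abs_coord_mul_upperWeight_le {t : ℝ} (ht : 0 < t) (a : EuclideanSpace ℝ (Fin d))
    (i : Fin d) : |a i * upperWeight (d + 1) t a| ≤ 1 * upperWeight d t a := by
  rw [one_mul]
  exact abs_mul_upperWeight_succ_le d ht a ((PiLp.norm_apply_le a i).trans (norm_le_upperNorm t a))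

theorem abs_mul_mul_upperWeight_le {t : ℝ} (ht : 0 < t) (a : EuclideanSpace ℝ (Fin d)) {α β : ℝ}
    (hα : |α| ≤ upperNorm t a) (hβ : |β| ≤ upperNorm t a) :
    |α * (β * upperWeight (d + 3) t a)| ≤ t⁻¹ * upperWeight d t a := by
  have h1 := abs_mul_upperWeight_succ_le (d + 2) ht a hβ
  have h2 := upperNorm_pos ht a
  rw [abs_mul]
  calc |α| * |β * upperWeight (d + 2 + 1) t a| ≤ |α| * upperWeight (d + 2) t a := by gcongr
    _ = |α * upperWeight (d + 2) t a| := by rw [abs_mul, abs_of_pos (upperWeight_pos _ ht a)]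
    _ ≤ upperWeight (d + 1) t a := abs_mul_upperWeight_succ_le (d + 1) ht a hα
    _ ≤ _ := upperWeight_succ_le d ht a

/-- Integration by parts moves the divergence of the horizontal field with pole below `z` onto the
vertical component with pole below `y`. The bracket on the left is that divergence, which also
equals minus the height derivative of the vertical component. -/
theorem integral_height_mul_div_upperRiesz (hd : d ≠ 0) {t t' : ℝ} (ht : 0 < t) (ht' : 0 < t')
    (y z : EuclideanSpace ℝ (Fin d)) :
    ∫ x, t * upperWeight (d + 1) t (x - y) * ((d + 1) * t' ^ 2 * upperWeight (d + 3) t' (x - z) -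
        upperWeight (d + 1) t' (x - z)) =
      ∫ x, (d + 1) * t * upperWeight (d + 3) t (x - y) * upperWeight (d + 1) t' (x - z) *
        inner ℝ (x - y) (x - z) := by
  have hcont : ∀ n, Continuous fun x => upperWeight n t (x - y) := fun n =>
    (continuous_upperWeight n ht).comp (continuous_sub_right y)
  have hcont' : ∀ n, Continuous fun x => upperWeight n t' (x - z) := fun n =>
    (continuous_upperWeight n ht').comp (continuous_sub_right z)
  -- the scalar factors of the vector field and their line derivatives
  set f : EuclideanSpace ℝ (Fin d) → ℝ := fun x => t * upperWeight (d + 1) t (x - y) with hf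
  set f' : Fin d → EuclideanSpace ℝ (Fin d) → ℝ := fun i x =>
    -(d + 1) * (t * ((x - y) i * upperWeight (d + 3) t (x - y))) with hf'
  set g : Fin d → EuclideanSpace ℝ (Fin d) → ℝ := fun i x =>
    (x - z) i * upperWeight (d + 1) t' (x - z) with hg
  set g' : Fin d → EuclideanSpace ℝ (Fin d) → ℝ := fun i x =>
    upperWeight (d + 1) t' (x - z) -
      (d + 1) * ((x - z) i * ((x - z) i * upperWeight (d + 3) t' (x - z))) with hg'
  have hfc : Continuous f := continuous_const.mul (hcont _)
  have hf'c : ∀ i, Continuous (f' i) := fun i => by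
    have := hcont (d + 3)
    simp only [hf', PiLp.sub_apply]
    fun_prop
  have hgc : ∀ i, Continuous (g i) := fun i => by
    have := hcont' (d + 1)
    simp only [hg, PiLp.sub_apply]
    fun_prop
  have hg'c : ∀ i, Continuous (g' i) := fun i => by
    have := hcont' (d + 1)
    have := hcont' (d + 3)
    simp only [hg', PiLp.sub_apply]
    fun_prop
  have hfb : ∀ x, |f x| ≤ 1 * upperWeight d t (x - y) := fun x =>
    abs_height_mul_upperWeight_le ht _
  have hf'b : ∀ i x, |f' i x| ≤ ((d + 1) * t⁻¹) * upperWeight d t (x - y) := fun i x => by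
    have := abs_mul_mul_upperWeight_le ht (x - y) (abs_le_upperNorm t _)
      ((PiLp.norm_apply_le (x - y) i).trans (norm_le_upperNorm t _))
    simp only [hf']
    rw [abs_mul, abs_neg, abs_of_nonneg (by positivity : (0 : ℝ) ≤ d + 1), mul_assoc]
    gcongr
  have hgb : ∀ i x, |g i x| ≤ 1 * upperWeight d t' (x - z) := fun i x =>
    abs_coord_mul_upperWeight_le ht' _ i
  have hg'b : ∀ i x, |g' i x| ≤ ((d + 2) * t'⁻¹) * upperWeight d t' (x - z) := fun i x => by
    have hi := (PiLp.norm_apply_le (x - z) i).trans (norm_le_upperNorm t' _)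
    have h1 := abs_mul_mul_upperWeight_le ht' (x - z) hi hi
    have h2 := upperWeight_succ_le d ht' (x - z)
    have h3 := upperWeight_pos (d + 1) ht' (x - z)
    simp only [hg']
    refine (abs_sub _ _).trans ?_
    rw [abs_of_pos h3, abs_mul, abs_of_nonneg (by positivity : (0 : ℝ) ≤ d + 1)]
    have h4 := mul_le_mul_of_nonneg_left h1 (by positivity : (0 : ℝ) ≤ d + 1)
    linarith
  have hint1 : ∀ i, Integrable fun x => f' i x * g i x := fun i =>
    integrable_of_abs_le_upperWeight_mul hd ht ht' y z ((hf'c i).mul (hgc i)) _ fun x =>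
      abs_mul_le_upperWeight_mul ht (by positivity) (hf'b i x) (hgb i x)
  have hint2 : ∀ i, Integrable fun x => f x * g' i x := fun i =>
    integrable_of_abs_le_upperWeight_mul hd ht ht' y z (hfc.mul (hg'c i)) _ fun x =>
      abs_mul_le_upperWeight_mul ht (by positivity) (hfb x) (hg'b i x)
  have hint3 : ∀ i, Integrable fun x => f x * g i x := fun i =>
    integrable_of_abs_le_upperWeight_mul hd ht ht' y z (hfc.mul (hgc i)) _ fun x =>
      abs_mul_le_upperWeight_mul ht (by positivity) (hfb x) (hgb i x)
  have hinner : ∀ (a : EuclideanSpace ℝ (Fin d)) (i : Fin d),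
      inner ℝ a (EuclideanSpace.single i (1 : ℝ)) = a i := fun a i => by
    simp [EuclideanSpace.inner_single_right]
  have hderf : ∀ i x, HasLineDerivAt ℝ f (f' i x) x (EuclideanSpace.single i (1 : ℝ)) := by
    intro i x
    have h1 := (hasLineDerivAt_upperWeight (d + 1) ht x y (EuclideanSpace.single i (1 : ℝ)))
    rw [hinner] at h1
    have h2 : HasDerivAt (fun σ : ℝ => t * upperWeight (d + 1) t
      (x + σ • EuclideanSpace.single i (1 : ℝ) - y)) _ 0 := HasDerivAt.const_mul t h1
    refine h2.congr_deriv ?_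
    simp only [hf']
    push_cast
    ring
  have hderg : ∀ i x, HasLineDerivAt ℝ (g i) (g' i x) x (EuclideanSpace.single i (1 : ℝ)) := by
    intro i x
    have h1 := (hasLineDerivAt_upperWeight (d + 1) ht' x z (EuclideanSpace.single i (1 : ℝ)))
    rw [hinner] at h1
    have h0 : HasDerivAt (fun σ : ℝ => (x + σ • EuclideanSpace.single i (1 : ℝ) - z) i) 1 0 := by
      have : (fun σ : ℝ => (x + σ • EuclideanSpace.single i (1 : ℝ) - z) i) =
          fun σ => σ + (x i - z i) := by
        funext σ
        simp
        ring
      rw [this]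
      exact (hasDerivAt_id' (0 : ℝ)).add_const _
    have h2 := HasDerivAt.mul h0 h1
    refine h2.congr_deriv ?_
    simp only [hg', zero_smul, add_zero]
    push_cast
    ring
  have hparts : ∀ i, ∫ x, f x * g' i x = - ∫ x, f' i x * g i x := fun i =>
    integral_bilinear_hasLineDerivAt_right_eq_neg_left_of_integrable
      (B := ContinuousLinearMap.mul ℝ ℝ) (hint1 i) (hint2 i) (hint3 i)
      (fun x _ => hderf i x) (fun x _ => hderg i x)
  have hsq : ∀ a : EuclideanSpace ℝ (Fin d), ∑ i, a i * a i = ‖a‖ ^ 2 := fun a => by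
    rw [EuclideanSpace.norm_sq_eq]
    exact Finset.sum_congr rfl fun i _ => by rw [Real.norm_eq_abs, sq_abs, sq]
  calc ∫ x, f x * ((d + 1) * t' ^ 2 * upperWeight (d + 3) t' (x - z) - upperWeight (d + 1) t' (x - z))
      = ∫ x, ∑ i, f x * g' i x := by
        congr 1
        funext x
        rw [← Finset.mul_sum]
        congr 1
        have h1 := upperWeight_add_two (d + 1) ht' (x - z)
        have h2 : ∑ i, g' i x = d * upperWeight (d + 1) t' (x - z) -
            (d + 1) * (‖x - z‖ ^ 2 * upperWeight (d + 3) t' (x - z)) := by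
          simp only [hg', Finset.sum_sub_distrib, ← Finset.mul_sum, ← hsq, Finset.sum_mul, mul_assoc]
          simp
        rw [h2]
        linear_combination ((d : ℝ) + 1) * h1
    _ = ∑ i, ∫ x, f x * g' i x := integral_finsetSum _ fun i _ => hint2 i
    _ = ∑ i, ∫ x, -(f' i x * g i x) := by
        refine Finset.sum_congr rfl fun i _ => ?_
        rw [hparts, integral_neg]
    _ = ∫ x, ∑ i, -(f' i x * g i x) := (integral_finsetSum _ fun i _ => (hint1 i).neg).symm
    _ = _ := by
        congr 1
        funext x
        simp only [hf', hg]
        rw [PiLp.inner_apply, Finset.mul_sum]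
        refine Finset.sum_congr rfl fun i _ => ?_
        simp only [RCLike.inner_apply, conj_trivial]
        ring

/-- With `abs_mul_inner_le`, this supplies the domination for differentiating under the integral; a
derivative costs one power of the height. -/
theorem abs_mul_div_upperRiesz_le {t t' : ℝ} (ht : 0 < t) (ht' : 0 < t')
    (a b : EuclideanSpace ℝ (Fin d)) :
    |t * upperWeight (d + 1) t a * ((d + 1) * t' ^ 2 * upperWeight (d + 3) t' b -
      upperWeight (d + 1) t' b)| ≤
      ((d + 2) * t'⁻¹) * (upperWeight d t a * upperWeight d t' b) := by
  have h0 := abs_mul_mul_upperWeight_le ht' b (abs_le_upperNorm t' b) (abs_le_upperNorm t' b)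
  have h1 := upperWeight_succ_le d ht' b
  have h2 := upperWeight_pos (d + 1) ht' b
  refine (abs_mul_le_upperWeight_mul ht zero_le_one (abs_height_mul_upperWeight_le ht a)
    (b := b) (t' := t') (B := (d + 2) * t'⁻¹) ?_).trans_eq (by ring)
  have h3 : (d + 1) * t' ^ 2 * upperWeight (d + 3) t' b =
      (d + 1) * (t' * (t' * upperWeight (d + 3) t' b)) := by ring
  rw [h3]
  refine (abs_sub _ _).trans ?_
  rw [abs_of_pos h2, abs_mul, abs_of_nonneg (by positivity : (0 : ℝ) ≤ d + 1)]
  have h4 := mul_le_mul_of_nonneg_left h0 (by positivity : (0 : ℝ) ≤ d + 1)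
  linarith

theorem abs_mul_inner_le {t t' : ℝ} (ht : 0 < t) (ht' : 0 < t')
    (a b : EuclideanSpace ℝ (Fin d)) :
    |(d + 1) * t * upperWeight (d + 3) t a * upperWeight (d + 1) t' b * inner ℝ a b| ≤
      ((d + 1) * t⁻¹) * (upperWeight d t a * upperWeight d t' b) := by
  have h1 := abs_mul_mul_upperWeight_le ht a (abs_le_upperNorm t a)
    ((abs_norm a).trans_le (norm_le_upperNorm t a))
  have h2 := abs_mul_upperWeight_succ_le d ht' b ((abs_norm b).trans_le (norm_le_upperNorm t' b))
  have h3 := abs_real_inner_le_norm a b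
  have h4 := upperWeight_pos (d + 1) ht' b
  have h5 := upperWeight_pos (d + 3) ht a
  have h6 := upperWeight_pos d ht a
  calc |(d + 1) * t * upperWeight (d + 3) t a * upperWeight (d + 1) t' b * inner ℝ a b|
      = (d + 1) * t * upperWeight (d + 3) t a * upperWeight (d + 1) t' b * |inner ℝ a b| := by
        rw [abs_mul, abs_of_nonneg (by positivity)]
    _ ≤ (d + 1) * t * upperWeight (d + 3) t a * upperWeight (d + 1) t' b * (‖a‖ * ‖b‖) := by gcongr
    _ = (d + 1) * (|t * (‖a‖ * upperWeight (d + 3) t a)| * |‖b‖ * upperWeight (d + 1) t' b|) := by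
        rw [abs_of_nonneg (by positivity), abs_of_nonneg (by positivity)]
        ring
    _ ≤ (d + 1) * ((t⁻¹ * upperWeight d t a) * upperWeight d t' b) := by gcongr
    _ = _ := by ring

theorem upperWeight_mul_anti {t t' T T' : ℝ} (ht : 0 < t) (ht' : 0 < t') (hT : t ≤ T) (hT' : t' ≤ T')
    (a b : EuclideanSpace ℝ (Fin d)) :
    upperWeight d T a * upperWeight d T' b ≤ upperWeight d t a * upperWeight d t' b := by
  have h1 := upperWeight_anti d ht hT a
  have h2 := upperWeight_anti d ht' hT' b
  have h3 := upperWeight_pos d ht a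
  have h4 := upperWeight_pos d (ht'.trans_le hT') b
  gcongr

/-- The Rellich identity for the harmonic vector fields generated by two points of the lower half
space: their horizontal and vertical parts have the same inner product on `ℝ ^ d`. -/
theorem integral_inner_upperRiesz (hd : d ≠ 0) {τ τ' : ℝ} (hτ : 0 < τ) (hτ' : 0 < τ')
    (y z : EuclideanSpace ℝ (Fin d)) :
    ∫ x, (inner ℝ (x - y) (x - z) - τ * τ') *
      (upperWeight (d + 1) τ (x - y) * upperWeight (d + 1) τ' (x - z)) = 0 := by
  -- Both heights will be raised together by `t`, starting from `τ - δ` and `τ' - δ`. The desired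
  -- integral is the one at `t = δ`, interior to the half line, and the base heights remain
  -- positive.
  obtain ⟨δ, hδ, hδτ, hδτ'⟩ : ∃ δ : ℝ, 0 < δ ∧ δ < τ ∧ δ < τ' :=
    ⟨min τ τ' / 2, by positivity, by linarith [min_le_left τ τ', lt_min hτ hτ'],
      by linarith [min_le_right τ τ', lt_min hτ hτ']⟩
  set σ := τ - δ with hσ
  set σ' := τ' - δ with hσ'
  have hσ0 : 0 < σ := sub_pos.2 hδτ
  have hσ0' : 0 < σ' := sub_pos.2 hδτ'
  set F : ℝ → EuclideanSpace ℝ (Fin d) → ℝ := fun t x =>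
    (inner ℝ (x - y) (x - z) - (σ + t) * (σ' + t)) *
      (upperWeight (d + 1) (σ + t) (x - y) * upperWeight (d + 1) (σ' + t) (x - z)) with hF
  set G1 : ℝ → EuclideanSpace ℝ (Fin d) → ℝ := fun t x =>
    (σ + t) * upperWeight (d + 1) (σ + t) (x - y) *
      ((d + 1) * (σ' + t) ^ 2 * upperWeight (d + 3) (σ' + t) (x - z) -
        upperWeight (d + 1) (σ' + t) (x - z)) with hG1
  set G2 : ℝ → EuclideanSpace ℝ (Fin d) → ℝ := fun t x =>
    (σ' + t) * upperWeight (d + 1) (σ' + t) (x - z) *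
      ((d + 1) * (σ + t) ^ 2 * upperWeight (d + 3) (σ + t) (x - y) -
        upperWeight (d + 1) (σ + t) (x - y)) with hG2
  set G3 : ℝ → EuclideanSpace ℝ (Fin d) → ℝ := fun t x =>
    (d + 1) * (σ + t) * upperWeight (d + 3) (σ + t) (x - y) *
      upperWeight (d + 1) (σ' + t) (x - z) * inner ℝ (x - y) (x - z) with hG3
  set G4 : ℝ → EuclideanSpace ℝ (Fin d) → ℝ := fun t x =>
    (d + 1) * (σ' + t) * upperWeight (d + 3) (σ' + t) (x - z) *
      upperWeight (d + 1) (σ + t) (x - y) * inner ℝ (x - z) (x - y) with hG4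
  set B : EuclideanSpace ℝ (Fin d) → ℝ := fun x =>
    upperWeight d σ (x - y) * upperWeight d σ' (x - z) with hB
  have hB0 : ∀ x, 0 ≤ B x := fun x =>
    mul_nonneg (upperWeight_pos d hσ0 _).le (upperWeight_pos d hσ0' _).le
  have hBint : Integrable B := integrable_upperWeight_mul hd hσ0 hσ0' y z
  have hBT : ∀ t, 0 < t → ∀ x, upperWeight d (σ + t) (x - y) * upperWeight d (σ' + t) (x - z) ≤ B x :=
    fun t ht x => upperWeight_mul_anti hσ0 hσ0' (by linarith) (by linarith) _ _
  set K : ℝ := (d + 2) * σ⁻¹ + (d + 2) * σ'⁻¹ with hK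
  have hK1 : ∀ t, 0 < t → (d + 2) * (σ + t)⁻¹ ≤ K := fun t ht => by
    have h1 : (σ + t)⁻¹ ≤ σ⁻¹ := by gcongr; linarith
    have h2 := mul_le_mul_of_nonneg_left h1 (by positivity : (0 : ℝ) ≤ d + 2)
    have h3 : 0 ≤ (d + 2) * σ'⁻¹ := by positivity
    linarith
  have hK2 : ∀ t, 0 < t → (d + 2) * (σ' + t)⁻¹ ≤ K := fun t ht => by
    have h1 : (σ' + t)⁻¹ ≤ σ'⁻¹ := by gcongr; linarith
    have h2 := mul_le_mul_of_nonneg_left h1 (by positivity : (0 : ℝ) ≤ d + 2)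
    have h3 : 0 ≤ (d + 2) * σ⁻¹ := by positivity
    linarith
  have hK0 : 0 ≤ K := by positivity
  have hbound : ∀ t : ℝ, 0 < t → ∀ x {c v W : ℝ}, c ≤ K → 0 ≤ W →
      W ≤ B x → |v| ≤ c * W → |v| ≤ K * B x := by
    intro t ht x c v W hc hW hWB hv
    exact hv.trans (mul_le_mul hc hWB hW hK0)
  have hW0 : ∀ t, 0 < t → ∀ x,
      0 ≤ upperWeight d (σ + t) (x - y) * upperWeight d (σ' + t) (x - z) := fun t ht x =>
    mul_nonneg (upperWeight_pos d (by linarith) _).le (upperWeight_pos d (by linarith) _).le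
  have hG1b : ∀ t, 0 < t → ∀ x, |G1 t x| ≤ K * B x := fun t ht x =>
    hbound t ht x (hK2 t ht) (hW0 t ht x) (hBT t ht x)
      (abs_mul_div_upperRiesz_le (by linarith) (by linarith) _ _)
  have hG2b : ∀ t, 0 < t → ∀ x, |G2 t x| ≤ K * B x := fun t ht x =>
    hbound t ht x (hK1 t ht) (hW0 t ht x) (hBT t ht x)
      ((abs_mul_div_upperRiesz_le (by linarith) (by linarith) _ _).trans_eq (by ring))
  have hone : ∀ T : ℝ, 0 < T → ((d : ℝ) + 1) * T⁻¹ ≤ (d + 2) * T⁻¹ := fun T hT => by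
    gcongr; norm_num
  have hG3b : ∀ t, 0 < t → ∀ x, |G3 t x| ≤ K * B x := fun t ht x =>
    hbound t ht x ((hone _ (by linarith)).trans (hK1 t ht)) (hW0 t ht x) (hBT t ht x)
      (abs_mul_inner_le (by linarith) (by linarith) _ _)
  have hG4b : ∀ t, 0 < t → ∀ x, |G4 t x| ≤ K * B x := fun t ht x =>
    hbound t ht x ((hone _ (by linarith)).trans (hK2 t ht)) (hW0 t ht x) (hBT t ht x)
      ((abs_mul_inner_le (by linarith) (by linarith) _ _).trans_eq (by ring))
  have hc : ∀ n t, 0 < t → Continuous fun x => upperWeight n (σ + t) (x - y) := fun n t ht =>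
    (continuous_upperWeight n (by linarith)).comp (continuous_sub_right y)
  have hc' : ∀ n t, 0 < t → Continuous fun x => upperWeight n (σ' + t) (x - z) := fun n t ht =>
    (continuous_upperWeight n (by linarith)).comp (continuous_sub_right z)
  have hG1c : ∀ t, 0 < t → Continuous (G1 t) := fun t ht => by
    have := hc (d + 1) t ht
    have := hc' (d + 1) t ht
    have := hc' (d + 3) t ht
    fun_prop
  have hG2c : ∀ t, 0 < t → Continuous (G2 t) := fun t ht => by
    have := hc' (d + 1) t ht
    have := hc (d + 1) t ht
    have := hc (d + 3) t ht
    fun_prop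
  have hG3c : ∀ t, 0 < t → Continuous (G3 t) := fun t ht => by
    have := hc' (d + 1) t ht
    have := hc (d + 3) t ht
    fun_prop
  have hG4c : ∀ t, 0 < t → Continuous (G4 t) := fun t ht => by
    have := hc (d + 1) t ht
    have := hc' (d + 3) t ht
    fun_prop
  have hFc : ∀ t, 0 < t → Continuous (F t) := fun t ht => by
    have := hc (d + 1) t ht
    have := hc' (d + 1) t ht
    fun_prop
  have hint : ∀ {G : EuclideanSpace ℝ (Fin d) → ℝ} {C : ℝ}, Continuous G →
      (∀ x, |G x| ≤ C * B x) → Integrable G := fun h1 h2 =>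
    integrable_of_abs_le_upperWeight_mul hd hσ0 hσ0' y z h1 _ h2
  have hFb' : ∀ t, 0 < t → ∀ x,
      |F t x| ≤ 2 * (upperWeight d (σ + t) (x - y) * upperWeight d (σ' + t) (x - z)) := by
    intro t ht x
    have hs : 0 < σ + t := by linarith
    have hs' : 0 < σ' + t := by linarith
    have e1 := norm_upperRiesz_le d (σ + t) (x - y)
    have e2 := norm_upperRiesz_le d (σ' + t) (x - z)
    have e3 := abs_height_mul_upperWeight_le hs (x - y)
    have e4 := abs_height_mul_upperWeight_le hs' (x - z)
    have e5 := abs_real_inner_le_norm (upperRiesz (d + 1) (σ + t) (x - y))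
      (upperRiesz (d + 1) (σ' + t) (x - z))
    have e6 : F t x = inner ℝ (upperRiesz (d + 1) (σ + t) (x - y))
        (upperRiesz (d + 1) (σ' + t) (x - z)) -
        ((σ + t) * upperWeight (d + 1) (σ + t) (x - y)) *
          ((σ' + t) * upperWeight (d + 1) (σ' + t) (x - z)) := by
      simp only [hF, upperRiesz, inner_smul_left, inner_smul_right, upperWeight, conj_trivial]
      ring
    have e7 := abs_mul_le_upperWeight_mul hs zero_le_one e3 e4
    have e8 : ‖upperRiesz (d + 1) (σ + t) (x - y)‖ * ‖upperRiesz (d + 1) (σ' + t) (x - z)‖ ≤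
        upperWeight d (σ + t) (x - y) * upperWeight d (σ' + t) (x - z) :=
      mul_le_mul e1 e2 (norm_nonneg _) (upperWeight_pos d hs _).le
    rw [e6]
    refine (abs_sub _ _).trans ?_
    linarith
  have hFb : ∀ t, 0 < t → ∀ x, |F t x| ≤ 2 * B x := fun t ht x =>
    (hFb' t ht x).trans (by linarith [hBT t ht x])
  -- The derivative of the integrand is `G1 + G2 - (G3 + G4)`, and integration by parts gives `G1`,
  -- `G3` and `G2`, `G4` equal integrals.
  have hderiv : ∀ t, 0 < t → HasDerivAt (fun t => ∫ x, F t x) 0 t := by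
    intro t ht
    have h1 := hasDerivAt_integral_of_dominated_loc_of_deriv_le (μ := volume) (F := F) (x₀ := t)
      (F' := fun t x => G1 t x + G2 t x - (G3 t x + G4 t x)) (s := Ioi 0) (bound := fun x => 4 * K * B x)
      (Ioi_mem_nhds ht)
      (by
        filter_upwards [Ioi_mem_nhds ht] with t ht
        exact (hFc t ht).aestronglyMeasurable)
      (hint (hFc t ht) (hFb t ht))
      (((hG1c t ht).add (hG2c t ht)).sub ((hG3c t ht).add (hG4c t ht))).aestronglyMeasurable
      (ae_of_all _ fun x t ht => by
        rw [Real.norm_eq_abs]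
        have k1 := abs_sub (G1 t x + G2 t x) (G3 t x + G4 t x)
        have k2 := abs_add_le (G1 t x) (G2 t x)
        have k3 := abs_add_le (G3 t x) (G4 t x)
        linarith [hG1b t ht x, hG2b t ht x, hG3b t ht x, hG4b t ht x])
      (hBint.const_mul _)
      (ae_of_all _ fun x t ht => by
        have ht : 0 < t := ht
        have k1 : HasDerivAt (fun t => upperWeight (d + 1) (σ + t) (x - y)) _ t :=
          (hasDerivAt_upperWeight (d + 1) (t := σ + t) (by linarith) (x - y)).comp_const_add σ t
        have k2 : HasDerivAt (fun t => upperWeight (d + 1) (σ' + t) (x - z)) _ t :=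
          (hasDerivAt_upperWeight (d + 1) (t := σ' + t) (by linarith) (x - z)).comp_const_add σ' t
        have k3 : HasDerivAt (fun t => inner ℝ (x - y) (x - z) - (σ + t) * (σ' + t))
            (-(1 * (σ' + t) + (σ + t) * 1)) t :=
          (((hasDerivAt_id' t).const_add σ).mul ((hasDerivAt_id' t).const_add σ')).const_sub _
        refine (k3.mul (k1.mul k2)).congr_deriv ?_
        simp only [Pi.mul_apply, hG1, hG2, hG3, hG4, real_inner_comm (x - y) (x - z)]
        push_cast
        ring)
    refine h1.2.congr_deriv ?_
    have i1 := hint (hG1c t ht) (hG1b t ht)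
    have i2 := hint (hG2c t ht) (hG2b t ht)
    have i3 := hint (hG3c t ht) (hG3b t ht)
    have i4 := hint (hG4c t ht) (hG4b t ht)
    have e0 : ∫ x, (G1 t x + G2 t x - (G3 t x + G4 t x)) =
        (∫ x, G1 t x) + (∫ x, G2 t x) - ((∫ x, G3 t x) + ∫ x, G4 t x) := by
      rw [← integral_add i1 i2, ← integral_add i3 i4]
      exact integral_sub (i1.add i2) (i3.add i4)
    have e1 : ∫ x, G1 t x = ∫ x, G3 t x :=
      integral_height_mul_div_upperRiesz hd (by linarith) (by linarith) y z
    have e2 : ∫ x, G2 t x = ∫ x, G4 t x :=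
      integral_height_mul_div_upperRiesz hd (by linarith) (by linarith) z y
    rw [e0, e1, e2, sub_self]
  have hconst : ∀ t, 0 < t → ∫ x, F t x = ∫ x, F δ x := by
    intro t ht
    refine isOpen_Ioi.is_const_of_deriv_eq_zero isPreconnected_Ioi
      (fun u hu => (hderiv u hu).differentiableAt.differentiableWithinAt)
      (fun u hu => (hderiv u hu).deriv) ht hδ
  -- The integral is constant in `t`, so it vanishes if it tends to 0; pointwise the integrand is
  -- $O(t^{-d})$, with `d ≠ 0`.
  have hlim : Tendsto (fun t => ∫ x, F t x) atTop (nhds (∫ _ : EuclideanSpace ℝ (Fin d), (0 : ℝ))) := by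
    refine tendsto_integral_filter_of_dominated_convergence (fun x => 2 * B x) ?_ ?_
      (hBint.const_mul 2) (ae_of_all _ fun x => ?_)
    · filter_upwards [eventually_gt_atTop 0] with t ht
      exact (hFc t ht).aestronglyMeasurable
    · filter_upwards [eventually_gt_atTop 0] with t ht
      exact ae_of_all _ fun x => hFb t ht x
    · have h1 : Tendsto (fun t : ℝ => 2 * ((t ^ d)⁻¹ * upperWeight d σ' (x - z))) atTop (nhds 0) := by
        have := ((tendsto_pow_atTop (α := ℝ) hd).inv_tendsto_atTop.mul_const
          (upperWeight d σ' (x - z))).const_mul 2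
        simpa using this
      refine squeeze_zero_norm' ?_ h1
      filter_upwards [eventually_gt_atTop 0] with t ht
      rw [Real.norm_eq_abs]
      refine (hFb' t ht x).trans ?_
      have k1 : upperWeight d (σ + t) (x - y) ≤ (t ^ d)⁻¹ := by
        unfold upperWeight
        gcongr
        linarith [le_upperNorm (σ + t) (x - y)]
      have k2 := upperWeight_anti d hσ0' (by linarith : σ' ≤ σ' + t) (x - z)
      have k3 := (upperWeight_pos d (by linarith : 0 < σ' + t) (x - z)).le
      gcongr
  have hzero : ∫ x, F δ x = 0 := by
    have h1 : Tendsto (fun t => ∫ x, F t x) atTop (nhds (∫ x, F δ x)) := by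
      refine tendsto_const_nhds.congr' ?_
      filter_upwards [eventually_gt_atTop 0] with t ht
      exact (hconst t ht).symm
    have := tendsto_nhds_unique h1 hlim
    simpa using this
  simpa [hF, hσ, hσ'] using hzero

end RellichIdentity

/-! ### The $L^2$ bound from growth of the measure -/

section SquareFunction

variable {d : ℕ}

theorem inner_upperRiesz (n : ℕ) (t t' : ℝ) (a b : EuclideanSpace ℝ (Fin d)) :
    inner ℝ (upperRiesz n t a) (upperRiesz n t' b) =
      inner ℝ a b * (upperWeight n t a * upperWeight n t' b) := by
  simp only [upperRiesz, inner_smul_left, inner_smul_right, upperWeight, conj_trivial]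
  ring

theorem integrable_inner_upperRiesz (hd : d ≠ 0) {t t' : ℝ} (ht : 0 < t) (ht' : 0 < t')
    (y z : EuclideanSpace ℝ (Fin d)) :
    Integrable fun x => inner ℝ (upperRiesz (d + 1) t (x - y)) (upperRiesz (d + 1) t' (x - z)) := by
  refine integrable_of_abs_le_upperWeight_mul hd ht ht' y z ?_ 1 fun x => ?_
  · exact ((continuous_upperRiesz _ ht).comp (continuous_sub_right y)).inner
      ((continuous_upperRiesz _ ht').comp (continuous_sub_right z))
  · rw [one_mul]
    exact (abs_real_inner_le_norm _ _).trans (mul_le_mul (norm_upperRiesz_le d t _)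
      (norm_upperRiesz_le d t' _) (norm_nonneg _) (upperWeight_pos d ht _).le)

theorem integrable_upperPoisson_mul (hd : d ≠ 0) {t t' : ℝ} (ht : 0 < t) (ht' : 0 < t')
    (y z : EuclideanSpace ℝ (Fin d)) :
    Integrable fun x => upperPoisson (d + 1) t (x - y) * upperPoisson (d + 1) t' (x - z) := by
  refine integrable_of_abs_le_upperWeight_mul hd ht ht' y z ?_ (1 * 1) fun x => ?_
  · exact ((continuous_upperPoisson _ ht).comp (continuous_sub_right y)).mul
      ((continuous_upperPoisson _ ht').comp (continuous_sub_right z))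
  · refine abs_mul_le_upperWeight_mul ht zero_le_one ?_ ?_ <;>
    · rw [one_mul]
      exact abs_upperPoisson_le d _ _

/-- This is where cancellation enters: inside an $L^2$ pairing, oscillating kernels are exchanged
for positive ones. -/
theorem integral_inner_upperRiesz_eq (hd : d ≠ 0) {t t' : ℝ} (ht : 0 < t) (ht' : 0 < t')
    (y z : EuclideanSpace ℝ (Fin d)) :
    ∫ x, inner ℝ (upperRiesz (d + 1) t (x - y)) (upperRiesz (d + 1) t' (x - z)) =
      ∫ x, upperPoisson (d + 1) t (x - y) * upperPoisson (d + 1) t' (x - z) := by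
  rw [← sub_eq_zero, ← integral_sub (integrable_inner_upperRiesz hd ht ht' y z)
    (integrable_upperPoisson_mul hd ht ht' y z), ← integral_inner_upperRiesz hd ht ht' y z]
  congr 1
  funext x
  rw [inner_upperRiesz, upperPoisson, upperPoisson, upperWeight, upperWeight]
  ring

/-- A substitute for the semigroup law: by `upperPoisson_mul_le` the kernel at the larger height
factors out, leaving Poisson kernels of uniformly bounded integral. -/
theorem exists_integral_upperPoisson_mul_le (hd : d ≠ 0) :
    ∃ C : ℝ, 0 ≤ C ∧ ∀ t t' : ℝ, 0 < t' → t' ≤ t → ∀ y z : EuclideanSpace ℝ (Fin d),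
      ∫ x, upperPoisson (d + 1) t (x - y) * upperPoisson (d + 1) t' (x - z) ≤
        C * upperPoisson (d + 1) t (z - y) := by
  obtain ⟨C, hC, h⟩ := exists_integral_upperPoisson_le d
  refine ⟨4 ^ (d + 1) * (2 * C), by positivity, fun t t' ht' htt y z => ?_⟩
  have ht := ht'.trans_le htt
  have hp := upperPoisson_nonneg (d + 1) ht.le (z - y)
  calc ∫ x, upperPoisson (d + 1) t (x - y) * upperPoisson (d + 1) t' (x - z)
      ≤ ∫ x, 4 ^ (d + 1) * upperPoisson (d + 1) t (z - y) *
          (upperPoisson (d + 1) t (x - y) + upperPoisson (d + 1) t' (x - z)) := by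
        refine integral_mono (integrable_upperPoisson_mul hd ht ht' y z)
          (((integrable_upperPoisson ht y).add (integrable_upperPoisson ht' z)).const_mul _)
          fun x => ?_
        have := upperPoisson_mul_le (d + 1) ht' htt (x - y) (x - z)
        rwa [sub_sub_sub_cancel_left] at this
    _ = 4 ^ (d + 1) * upperPoisson (d + 1) t (z - y) *
          ((∫ x, upperPoisson (d + 1) t (x - y)) + ∫ x, upperPoisson (d + 1) t' (x - z)) := by
        rw [integral_const_mul]
        congr 1
        exact integral_add (integrable_upperPoisson ht y) (integrable_upperPoisson ht' z)
    _ ≤ 4 ^ (d + 1) * upperPoisson (d + 1) t (z - y) * (C + C) := by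
        gcongr
        exacts [h t ht y, h t' ht' z]
    _ = _ := by ring

/-- A measure with growth of order `d` at the scales above `τ` has a bounded Poisson extension at
the height `τ`. -/
theorem sum_mul_upperPoisson_le {ι : Type*} (S : Finset ι) {c : ι → ℝ} (hc : ∀ j, 0 ≤ c j)
    (z : ι → EuclideanSpace ℝ (Fin d)) (x : EuclideanSpace ℝ (Fin d)) {τ A : ℝ} (hτ : 0 < τ)
    (hA : 0 ≤ A) (h : ∀ ρ, τ ≤ ρ → ∑ j ∈ S with ‖z j - x‖ ≤ ρ, c j ≤ A * ρ ^ d) :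
    ∑ j ∈ S, c j * upperPoisson (d + 1) τ (z j - x) ≤ 2 ^ (d + 2) * A := by
  classical
  have hex : ∀ j, ∃ k : ℕ, ‖z j - x‖ ≤ 2 ^ k * τ := fun j => by
    obtain ⟨k, hk⟩ := pow_unbounded_of_one_lt (‖z j - x‖ / τ) (one_lt_two)
    exact ⟨k, by rw [div_lt_iff₀ hτ] at hk; exact hk.le⟩
  -- The first dyadic radius $2^k\tau$ reaching `z j`. There the kernel is at most `w k`, and growth
  -- turns the masses within $2^m\tau$ into a term of a geometric series of ratio 1/2.
  set k : ι → ℕ := fun j => Nat.find (hex j) with hk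
  obtain ⟨K, hK⟩ : ∃ K, ∀ j ∈ S, k j < K := by
    obtain ⟨K, hK⟩ := (S.image k).exists_nat_subset_range
    exact ⟨K, fun j hj => Finset.mem_range.1 (hK (Finset.mem_image_of_mem k hj))⟩
  set w : ℕ → ℝ := fun m => τ * 2 ^ (d + 1) / (2 ^ m * τ) ^ (d + 1) with hw
  have hw0 : ∀ m, 0 ≤ w m := fun m => by positivity
  have hpt : ∀ j, upperPoisson (d + 1) τ (z j - x) ≤ w (k j) := by
    intro j
    have h1 := upperNorm_pos hτ (z j - x)
    have h2 : 2 ^ k j * τ ≤ 2 * upperNorm τ (z j - x) := by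
      rcases hkj : k j with _ | m
      · linarith [le_upperNorm τ (z j - x)]
      · have h3 : ¬ ‖z j - x‖ ≤ 2 ^ m * τ := Nat.find_min (hex j) (by
          change m < k j
          omega)
        rw [pow_succ]
        linarith [norm_le_upperNorm τ (z j - x)]
    rw [upperPoisson, hw]
    simp only
    rw [div_le_div_iff₀ (by positivity) (by positivity), mul_assoc, ← mul_pow]
    gcongr
  calc ∑ j ∈ S, c j * upperPoisson (d + 1) τ (z j - x)
      ≤ ∑ j ∈ S, ∑ m ∈ Finset.range K, if ‖z j - x‖ ≤ 2 ^ m * τ then w m * c j else 0 := by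
        refine Finset.sum_le_sum fun j hj => ?_
        have h1 : (if ‖z j - x‖ ≤ 2 ^ k j * τ then w (k j) * c j else 0) ≤
            ∑ m ∈ Finset.range K, if ‖z j - x‖ ≤ 2 ^ m * τ then w m * c j else 0 :=
          Finset.single_le_sum (f := fun m => if ‖z j - x‖ ≤ 2 ^ m * τ then w m * c j else 0)
            (fun m _ => by
              split_ifs
              exacts [mul_nonneg (hw0 m) (hc j), le_rfl]) (Finset.mem_range.2 (hK j hj))
        rw [if_pos (Nat.find_spec (hex j))] at h1
        refine le_trans ?_ h1
        rw [mul_comm]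
        exact mul_le_mul_of_nonneg_right (hpt j) (hc j)
    _ = ∑ m ∈ Finset.range K, w m * ∑ j ∈ S with ‖z j - x‖ ≤ 2 ^ m * τ, c j := by
        rw [Finset.sum_comm]
        refine Finset.sum_congr rfl fun m _ => ?_
        rw [Finset.mul_sum, Finset.sum_filter]
    _ ≤ ∑ m ∈ Finset.range K, w m * (A * (2 ^ m * τ) ^ d) := by
        gcongr with m _
        exact h _ (le_mul_of_one_le_left hτ.le (one_le_pow₀ (by norm_num)))
    _ = ∑ m ∈ Finset.range K, 2 ^ (d + 1) * A * (1 / 2 : ℝ) ^ m := by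
        refine Finset.sum_congr rfl fun m _ => ?_
        simp only [hw]
        rw [pow_succ (2 ^ m * τ), one_div_pow]
        field_simp
    _ = 2 ^ (d + 1) * A * ∑ m ∈ Finset.range K, (1 / 2 : ℝ) ^ m := by rw [Finset.mul_sum]
    _ ≤ 2 ^ (d + 1) * A * 2 := by
        gcongr
        rw [geom_sum_eq (by norm_num), div_le_iff_of_neg (by norm_num)]
        have : (0 : ℝ) ≤ (1 / 2) ^ K := by positivity
        linarith
    _ = _ := by ring

/-- The `L²` bound for the extension of the Riesz transform of a measure with growth of order `d`,
whose point masses are lifted to various heights. -/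
theorem exists_integral_norm_sq_upperRiesz_le (hd : d ≠ 0) :
    ∃ C : ℝ, 0 ≤ C ∧ ∀ {ι : Type} (S : Finset ι) (c a : ι → ℝ) (z : ι → EuclideanSpace ℝ (Fin d))
      (A : ℝ), (∀ j, 0 ≤ c j) → (∀ j, 0 < a j) → 0 ≤ A →
      (∀ j ∈ S, ∀ ρ, a j ≤ ρ →
        ∑ k ∈ S with a k ≤ a j ∧ ‖z k - z j‖ ≤ ρ, c k ≤ A * ρ ^ d) →
      Integrable (fun x => ‖∑ j ∈ S, c j • upperRiesz (d + 1) (a j) (x - z j)‖ ^ 2) ∧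
      ∫ x, ‖∑ j ∈ S, c j • upperRiesz (d + 1) (a j) (x - z j)‖ ^ 2 ≤ C * A * ∑ j ∈ S, c j := by
  obtain ⟨C, hC, h⟩ := exists_integral_upperPoisson_mul_le hd
  refine ⟨2 * C * 2 ^ (d + 2), by positivity, fun {ι} S c a z A hc ha hA hgrow => ?_⟩
  have hexp : (fun x => ‖∑ j ∈ S, c j • upperRiesz (d + 1) (a j) (x - z j)‖ ^ 2) =
      fun x => ∑ j ∈ S, ∑ k ∈ S, c j * c k *
        inner ℝ (upperRiesz (d + 1) (a j) (x - z j)) (upperRiesz (d + 1) (a k) (x - z k)) := by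
    funext x
    rw [← real_inner_self_eq_norm_sq, sum_inner]
    refine Finset.sum_congr rfl fun j _ => ?_
    rw [inner_sum]
    refine Finset.sum_congr rfl fun k _ => ?_
    rw [inner_smul_left, inner_smul_right, conj_trivial]
    ring
  have hint : ∀ j k, Integrable fun x => c j * c k *
      inner ℝ (upperRiesz (d + 1) (a j) (x - z j)) (upperRiesz (d + 1) (a k) (x - z k)) :=
    fun j k => (integrable_inner_upperRiesz hd (ha j) (ha k) _ _).const_mul _
  rw [hexp]
  refine ⟨integrable_finsetSum _ fun j _ => integrable_finsetSum _ fun k _ => hint j k, ?_⟩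
  rw [integral_finsetSum _ fun j _ => integrable_finsetSum _ fun k _ => hint j k]
  set I : ι → ι → ℝ := fun j k =>
    ∫ x, upperPoisson (d + 1) (a j) (x - z j) * upperPoisson (d + 1) (a k) (x - z k) with hI
  have hIsymm : ∀ j k, I j k = I k j := fun j k => by
    simp only [hI, mul_comm]
  have hI0 : ∀ j k, 0 ≤ I j k := fun j k => integral_nonneg fun x =>
    mul_nonneg (upperPoisson_nonneg _ (ha j).le _) (upperPoisson_nonneg _ (ha k).le _)
  have hIle : ∀ j k, a k ≤ a j → I j k ≤ C * upperPoisson (d + 1) (a j) (z k - z j) :=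
    fun j k hjk => h _ _ (ha k) hjk _ _
  -- Growth about `z j` is assumed only for masses of no greater height. By symmetry of `I`, the
  -- full double sum is at most twice this half.
  set T : ℝ := ∑ j ∈ S, ∑ k ∈ S with a k ≤ a j, c j * c k * I j k with hT
  have hTle : T ≤ ∑ j ∈ S, c j * (C * (2 ^ (d + 2) * A)) := by
    refine Finset.sum_le_sum fun j hj => ?_
    calc ∑ k ∈ S with a k ≤ a j, c j * c k * I j k
        ≤ ∑ k ∈ S with a k ≤ a j, c j * (C * (c k * upperPoisson (d + 1) (a j) (z k - z j))) := by
          refine Finset.sum_le_sum fun k hk => ?_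
          have h1 := hIle j k (Finset.mem_filter.1 hk).2
          calc c j * c k * I j k ≤ c j * c k * (C * upperPoisson (d + 1) (a j) (z k - z j)) :=
                mul_le_mul_of_nonneg_left h1 (mul_nonneg (hc j) (hc k))
            _ = _ := by ring
      _ = c j * (C * ∑ k ∈ S with a k ≤ a j, c k * upperPoisson (d + 1) (a j) (z k - z j)) := by
          rw [← Finset.mul_sum, ← Finset.mul_sum]
      _ ≤ c j * (C * (2 ^ (d + 2) * A)) := by
          refine mul_le_mul_of_nonneg_left (mul_le_mul_of_nonneg_left ?_ hC) (hc j)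
          refine sum_mul_upperPoisson_le _ hc z (z j) (ha j) hA fun ρ hρ => ?_
          rw [Finset.filter_filter]
          exact hgrow j hj ρ hρ
  calc ∑ j ∈ S, ∫ x, ∑ k ∈ S, c j * c k *
        inner ℝ (upperRiesz (d + 1) (a j) (x - z j)) (upperRiesz (d + 1) (a k) (x - z k))
      = ∑ j ∈ S, ∑ k ∈ S, c j * c k * I j k := by
        refine Finset.sum_congr rfl fun j _ => ?_
        rw [integral_finsetSum _ fun k _ => hint j k]
        refine Finset.sum_congr rfl fun k _ => ?_
        rw [integral_const_mul, integral_inner_upperRiesz_eq hd (ha j) (ha k)]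
    _ ≤ ∑ j ∈ S, ∑ k ∈ S, ((if a k ≤ a j then c j * c k * I j k else 0) +
          if a j ≤ a k then c k * c j * I k j else 0) := by
        refine Finset.sum_le_sum fun j _ => Finset.sum_le_sum fun k _ => ?_
        have h1 : 0 ≤ c j * c k * I j k := mul_nonneg (mul_nonneg (hc j) (hc k)) (hI0 j k)
        rw [hIsymm k j, mul_comm (c k)]
        rcases le_total (a k) (a j) with h2 | h2
        · rw [if_pos h2]
          split_ifs <;> linarith
        · rw [if_pos h2]
          split_ifs <;> linarith
    _ = T + T := by
        simp only [Finset.sum_add_distrib]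
        congr 1
        · simp only [hT, Finset.sum_filter]
        · rw [Finset.sum_comm]
          simp only [hT, Finset.sum_filter]
    _ ≤ _ := by
        rw [← Finset.sum_mul] at hTle
        linarith

end SquareFunction

/-! ### Stopping radii and clusters of point masses -/

section Clustering

variable {d : ℕ}

/-- The point masses `c j` at `y j` are grouped into clusters: the mass `c j` belongs to the cluster
with centre `z j` and size `a j ≥ r`, and there is growth of order `d` above the size of a cluster. -/
structure IsClustering {ι : Type} [Fintype ι] (c : ι → ℝ) (y z : ι → EuclideanSpace ℝ (Fin d))
    (a : ι → ℝ) (P r : ℝ) : Prop where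
  nonneg : ∀ j, 0 ≤ c j
  density_pos : 0 < P
  scale_pos : 0 < r
  scale_le : ∀ j, r ≤ a j
  norm_sub_le : ∀ j, ‖y j - z j‖ ≤ 5 * a j
  growth : ∀ j ρ, 2 * a j ≤ ρ → ∑ k with ‖y k - z j‖ ≤ ρ, c k ≤ P * ρ ^ d

/-- The heavy radii are bounded by finiteness of the mass, and `r` is added to make the set
nonempty. Any member above half the supremum will do, since its double exceeds the supremum;
attainment is not needed. -/
theorem exists_last_heavy_radius (hd : d ≠ 0) {ι : Type} [Fintype ι] {c : ι → ℝ} (hc : ∀ j, 0 ≤ c j)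
    (y : ι → EuclideanSpace ℝ (Fin d)) {P r : ℝ} (hP : 0 < P) (hr : 0 < r)
    (x : EuclideanSpace ℝ (Fin d)) :
    ∃ ρ, r ≤ ρ ∧ (ρ = r ∨ P * ρ ^ d ≤ ∑ k with ‖y k - x‖ ≤ ρ, c k) ∧
      ∀ σ, 2 * ρ ≤ σ → ∑ k with ‖y k - x‖ ≤ σ, c k ≤ P * σ ^ d := by
  set T : Set ℝ := {ρ | r ≤ ρ ∧ (ρ = r ∨ P * ρ ^ d ≤ ∑ k with ‖y k - x‖ ≤ ρ, c k)} with hT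
  have hrT : r ∈ T := ⟨le_rfl, Or.inl rfl⟩
  have hbdd : BddAbove T := by
    refine ⟨max r (max 1 ((∑ k, c k) / P)), ?_⟩
    rintro ρ ⟨-, rfl | h⟩
    · exact le_max_left _ _
    · refine le_trans ?_ (le_max_right _ _)
      rcases le_total ρ 1 with h1 | h1
      · exact h1.trans (le_max_left _ _)
      · refine le_trans ?_ (le_max_right _ _)
        rw [le_div_iff₀ hP, mul_comm]
        calc P * ρ ≤ P * ρ ^ d := by gcongr; exact le_self_pow₀ h1 hd
          _ ≤ _ := h
          _ ≤ ∑ k, c k := Finset.sum_le_sum_of_subset_of_nonneg (Finset.filter_subset _ _)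
              fun k _ _ => hc k
  have hsup : r ≤ sSup T := le_csSup hbdd hrT
  obtain ⟨ρ, hρT, hρ⟩ := exists_lt_of_lt_csSup ⟨r, hrT⟩ (half_lt_self (hr.trans_le hsup))
  refine ⟨ρ, hρT.1, hρT.2, fun σ hσ => ?_⟩
  by_contra! h
  have h1 : σ ∈ T := ⟨by linarith [hρT.1], Or.inr h.le⟩
  linarith [le_csSup hbdd h1]

/-- A Vitali argument groups any finite family of point masses into clusters of small total size. -/
theorem exists_isClustering (hd : d ≠ 0) {ι : Type} [Fintype ι] {c : ι → ℝ} (hc : ∀ j, 0 ≤ c j)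
    (y : ι → EuclideanSpace ℝ (Fin d)) {P : ℝ} {r : ℝ≥0} (hP : 0 < P) (hr : 0 < r) :
    ∃ (z : ι → EuclideanSpace ℝ (Fin d)) (a : ι → ℝ), IsClustering c y z a P r ∧
      HasBallCover r (⋃ j, Metric.ball (z j) (20 * a j))
        (ENNReal.ofReal (20 ^ d * (Fintype.card ι * (r : ℝ) ^ d + (∑ j, c j) / P))) := by
  classical
  have hr' : (0 : ℝ) < r := hr
  choose ρ hρr hρ hρgrow using fun j => exists_last_heavy_radius hd hc y hP hr' (y j)
  have hρ0 : ∀ j, 0 < ρ j := fun j => hr'.trans_le (hρr j)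
  obtain ⟨u, -, hdisj, hcov⟩ := Vitali.exists_disjoint_subfamily_covering_enlargement_closedBall
    (univ : Set ι) y ρ (∑ j, ρ j)
    (fun j _ => Finset.single_le_sum (f := ρ) (fun k _ => (hρ0 k).le) (Finset.mem_univ j)) 5
    (by norm_num)
  choose b hbu hb using fun j => hcov j (mem_univ j)
  set U : Finset ι := Finset.univ.filter (· ∈ u) with hU
  -- A selected ball has radius `r`, which happens at most `card ι` times, or carries mass at least
  -- `P * ρ ^ d`; the selected balls are disjoint, so these masses add up.
  have hsum : ∑ i ∈ U, ρ i ^ d ≤ Fintype.card ι * (r : ℝ) ^ d + (∑ j, c j) / P := by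
    have h1 : ∀ i ∈ U, ρ i ^ d ≤ (r : ℝ) ^ d + (∑ k with ‖y k - y i‖ ≤ ρ i, c k) / P := by
      intro i _
      have h0 : 0 ≤ ∑ k with ‖y k - y i‖ ≤ ρ i, c k := Finset.sum_nonneg fun k _ => hc k
      rcases hρ i with h | h
      · rw [h] at h0 ⊢
        have := div_nonneg h0 hP.le
        linarith
      · have h2 : ρ i ^ d ≤ (∑ k with ‖y k - y i‖ ≤ ρ i, c k) / P := by
          rw [le_div_iff₀ hP, mul_comm]
          exact h
        have : 0 ≤ (r : ℝ) ^ d := by positivity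
        linarith
    refine (Finset.sum_le_sum h1).trans ?_
    rw [Finset.sum_add_distrib, Finset.sum_const, nsmul_eq_mul, ← Finset.sum_div]
    gcongr
    · exact Finset.card_le_univ U
    · rw [← Finset.sum_biUnion]
      · exact Finset.sum_le_sum_of_subset_of_nonneg (Finset.subset_univ _) fun k _ _ => hc k
      · intro i hi j hj hij
        rw [Function.onFun, Finset.disjoint_left]
        intro k hki hkj
        have hi' : i ∈ u := (Finset.mem_filter.1 hi).2
        have hj' : j ∈ u := (Finset.mem_filter.1 hj).2
        refine Set.disjoint_left.1 (hdisj hi' hj' hij) (show y k ∈ _ from ?_) ?_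
        · rw [Metric.mem_closedBall, dist_eq_norm]
          exact (Finset.mem_filter.1 hki).2
        · rw [Metric.mem_closedBall, dist_eq_norm]
          exact (Finset.mem_filter.1 hkj).2
  -- The cluster of `j` is the selected ball `b j` whose fivefold enlargement contains the ball of
  -- `j`.
  refine ⟨fun j => y (b j), fun j => ρ (b j), ⟨hc, hP, hr', fun j => hρr _, fun j => ?_,
    fun j σ hσ => hρgrow (b j) σ hσ⟩, ?_⟩
  · have h1 := hb j (Metric.mem_closedBall_self (hρ0 j).le)
    rwa [Metric.mem_closedBall, dist_eq_norm] at h1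
  · refine (hasBallCover_biUnion_finset U (r := r) y (fun i => (20 * ρ i).toNNReal)
      fun i _ => ?_).mono ?_ ?_
    · rw [← NNReal.coe_le_coe, Real.coe_toNNReal _ (by linarith [hρ0 i])]
      linarith [hρr i, hρ0 i]
    · refine iUnion_subset fun j => ?_
      refine subset_biUnion_of_mem (u := fun i => Metric.ball (y i) ((20 * ρ i).toNNReal : ℝ))
        (show b j ∈ U from Finset.mem_filter.2 ⟨Finset.mem_univ _, hbu j⟩) |>.trans' ?_
      simp only
      rw [Real.coe_toNNReal _ (by linarith [hρ0 (b j)])]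
    · calc ∑ i ∈ U, ((20 * ρ i).toNNReal : ℝ≥0∞) ^ d
          = ∑ i ∈ U, ENNReal.ofReal ((20 * ρ i) ^ d) := by
            refine Finset.sum_congr rfl fun i _ => ?_
            rw [ENNReal.ofReal_pow (by linarith [hρ0 i])]
            rfl
        _ = ENNReal.ofReal (∑ i ∈ U, (20 * ρ i) ^ d) := by
            rw [ENNReal.ofReal_sum_of_nonneg]
            intro i _
            have := hρ0 i
            positivity
        _ ≤ _ := by
            refine ENNReal.ofReal_le_ofReal ?_
            simp only [mul_pow]
            rw [← Finset.mul_sum]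
            gcongr

namespace IsClustering

variable {ι : Type} [Fintype ι] {c : ι → ℝ} {y z : ι → EuclideanSpace ℝ (Fin d)} {a : ι → ℝ}
  {P r : ℝ}

theorem size_pos (h : IsClustering c y z a P r) (j : ι) : 0 < a j :=
  h.scale_pos.trans_le (h.scale_le j)

theorem sum_le_sum_filter (h : IsClustering c y z a P r) {p q : ι → Prop} [DecidablePred p]
    [DecidablePred q] (hpq : ∀ j, p j → q j) : ∑ j with p j, c j ≤ ∑ j with q j, c j :=
  Finset.sum_le_sum_of_subset_of_nonneg
    (fun j hj => Finset.mem_filter.2 ⟨Finset.mem_univ j, hpq j (Finset.mem_filter.1 hj).2⟩)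
    fun j _ _ => h.nonneg j

/-- A mass of a cluster of size at most `a j` was moved by at most `5 * ρ`, hence lay within `6 * ρ`
of `z j`. Masses of larger clusters may have come from farther away. -/
theorem growth_center (h : IsClustering c y z a P r) (j : ι) {ρ : ℝ} (hρ : a j ≤ ρ) :
    ∑ k with a k ≤ a j ∧ ‖z k - z j‖ ≤ ρ, c k ≤ (6 ^ d * P) * ρ ^ d := by
  have ha := h.size_pos j
  refine (h.sum_le_sum_filter (q := fun k => ‖y k - z j‖ ≤ 6 * ρ) ?_).trans
    ((h.growth j (6 * ρ) (by linarith)).trans_eq (by rw [mul_pow]; ring))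
  rintro k ⟨hk1, hk2⟩
  have h1 := norm_add_le (y k - z k) (z k - z j)
  rw [sub_add_sub_cancel] at h1
  linarith [h.norm_sub_le k]

/-- Far from all clusters growth holds at every scale. If the ball about `x` contains some `y j`,
then `‖z j - x‖ ≤ 4 * ρ / 3`, so the ball lies in that of radius `3 * ρ` about `z j`, a radius above
`2 * a j`. -/
theorem growth_point (h : IsClustering c y z a P r) {x : EuclideanSpace ℝ (Fin d)}
    (hx : ∀ j, 20 * a j ≤ ‖z j - x‖) {ρ : ℝ} (hρ : 0 ≤ ρ) :
    ∑ k with ‖y k - x‖ ≤ ρ, c k ≤ (3 ^ d * P) * ρ ^ d := by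
  have hP := h.density_pos
  by_cases hne : ∃ j, ‖y j - x‖ ≤ ρ
  · obtain ⟨j, hj⟩ := hne
    have h1 := norm_sub_norm_le (z j - x) (z j - y j)
    rw [sub_sub_sub_cancel_left] at h1
    have h2 := h.norm_sub_le j
    rw [norm_sub_rev] at h2
    have h3 := hx j
    have h4 := h.size_pos j
    refine (h.sum_le_sum_filter (q := fun k => ‖y k - z j‖ ≤ 3 * ρ) ?_).trans
      ((h.growth j (3 * ρ) (by linarith)).trans_eq (by rw [mul_pow]; ring))
    intro k hk
    have h5 := _root_.norm_sub_le (y k - x) (z j - x)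
    rw [sub_sub_sub_cancel_right] at h5
    linarith
  · push Not at hne
    rw [Finset.filter_false_of_mem fun j _ => not_le.2 (hne j), Finset.sum_empty]
    positivity

theorem growth_center_point (h : IsClustering c y z a P r) {x : EuclideanSpace ℝ (Fin d)}
    (hx : ∀ j, 20 * a j ≤ ‖z j - x‖) {ρ : ℝ} (hρ : 0 ≤ ρ) :
    ∑ k with ‖z k - x‖ ≤ ρ, c k ≤ (6 ^ d * P) * ρ ^ d := by
  refine (h.sum_le_sum_filter (q := fun k => ‖y k - x‖ ≤ 2 * ρ) ?_).trans
    ((h.growth_point hx (ρ := 2 * ρ) (by linarith)).trans_eq ?_)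
  · intro k hk
    have h1 := norm_add_le (y k - z k) (z k - x)
    rw [sub_add_sub_cancel] at h1
    linarith [h.norm_sub_le k, hx k, norm_nonneg (z k - x)]
  · rw [mul_pow, show (6 : ℝ) = 3 * 2 by norm_num, mul_pow]
    ring

/-- The Poisson extension of the clustered measure. -/
theorem integrable_sum_upperPoisson (h : IsClustering c y z a P r) :
    Integrable fun x => ∑ j, c j * upperPoisson (d + 1) (a j) (x - z j) :=
  integrable_finsetSum _ fun j _ => (integrable_upperPoisson (h.size_pos j) (z j)).const_mul _

/-- Away from the clusters, the truncated Riesz transform is close to that of the clustered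
measure. -/
theorem norm_sum_sub_sum_le (h : IsClustering c y z a P r) {x : EuclideanSpace ℝ (Fin d)}
    (hx : ∀ j, 20 * a j ≤ ‖z j - x‖) {ε : ℝ} (hε : 0 < ε) :
    ‖∑ j with ε < ‖y j - x‖, c j • upperRiesz (d + 1) 0 (x - y j) -
      ∑ j with ε < ‖z j - x‖, c j • upperRiesz (d + 1) (a j) (x - z j)‖ ≤
      (d + 2) * 6 * 2 ^ (d + 1) * ∑ j, c j * upperPoisson (d + 1) (a j) (x - z j) + 6 ^ d * P := by
  -- If both positions are beyond `ε`, the displacement is at most `6 * a j` and the Lipschitz bound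
  -- yields the Poisson kernel. If only one is, then `y j` is within `2 * ε` and the surviving
  -- kernel is at most $\varepsilon^{-d}$.
  have hterm : ∀ j, ‖(if ε < ‖y j - x‖ then c j • upperRiesz (d + 1) 0 (x - y j) else 0) -
      (if ε < ‖z j - x‖ then c j • upperRiesz (d + 1) (a j) (x - z j) else 0)‖ ≤
      (d + 2) * 6 * 2 ^ (d + 1) * (c j * upperPoisson (d + 1) (a j) (x - z j)) +
        if ‖y j - x‖ ≤ 2 * ε then (ε ^ d)⁻¹ * c j else 0 := by
    intro j
    have hc := h.nonneg j
    have ha := h.size_pos j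
    have hp := upperPoisson_nonneg (d + 1) ha.le (x - z j)
    have hx := hx j
    have hyz := h.norm_sub_le j
    have hy1 := norm_sub_norm_le (z j - x) (z j - y j)
    rw [sub_sub_sub_cancel_left, norm_sub_rev (z j) (y j)] at hy1
    have hy2 := norm_add_le (y j - z j) (z j - x)
    rw [sub_add_sub_cancel] at hy2
    have hpos : 0 ≤ (d + 2) * 6 * 2 ^ (d + 1) * (c j * upperPoisson (d + 1) (a j) (x - z j)) := by
      positivity
    have hpos' : 0 ≤ if ‖y j - x‖ ≤ 2 * ε then (ε ^ d)⁻¹ * c j else 0 := by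
      split_ifs
      exacts [by positivity, le_rfl]
    by_cases h1 : ε < ‖y j - x‖ <;> by_cases h2 : ε < ‖z j - x‖
    · rw [if_pos h1, if_pos h2, ← smul_sub, norm_smul, Real.norm_of_nonneg hc]
      have hN := upperNorm_pos ha (x - z j)
      have hN1 := upperNorm_le_add ha.le (x - z j)
      rw [norm_sub_rev] at hN1
      have h3 := norm_upperRiesz_sub_le (d + 1) (l := upperNorm (a j) (x - z j) / 2) (by positivity)
        (t := 0) (t' := a j) (x := x - y j) (x' := x - z j)
        (by rw [upperNorm_zero_left, norm_sub_rev]; linarith) (by linarith)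
      rw [sub_sub_sub_cancel_left, norm_sub_rev (z j), zero_sub, abs_neg, abs_of_pos ha] at h3
      have h4 : ‖upperRiesz (d + 1) 0 (x - y j) - upperRiesz (d + 1) (a j) (x - z j)‖ ≤
          (d + 2) * 6 * 2 ^ (d + 1) * upperPoisson (d + 1) (a j) (x - z j) := by
        refine h3.trans ?_
        rw [upperPoisson, div_pow, div_div_eq_mul_div, ← mul_div_assoc]
        refine div_le_div_of_nonneg_right ?_ (by positivity)
        push_cast
        calc ((d : ℝ) + 1 + 1) * (‖y j - z j‖ + a j) * 2 ^ (d + 1)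
            ≤ ((d : ℝ) + 1 + 1) * (6 * a j) * 2 ^ (d + 1) := by gcongr; linarith
          _ = _ := by ring
      have h5 := mul_le_mul_of_nonneg_left h4 hc
      linarith
    · rw [if_pos h1, if_neg h2, sub_zero, norm_smul, Real.norm_of_nonneg hc,
        if_pos (by push Not at h2; linarith)]
      have h3 := norm_upperRiesz_le d 0 (x - y j)
      rw [upperNorm_zero_left, norm_sub_rev] at h3
      have h4 : (‖y j - x‖ ^ d)⁻¹ ≤ (ε ^ d)⁻¹ := by gcongr
      have h5 := mul_le_mul_of_nonneg_left (h3.trans h4) hc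
      linarith
    · rw [if_neg h1, if_pos h2, zero_sub, norm_neg, norm_smul, Real.norm_of_nonneg hc,
        if_pos (by push Not at h1; linarith)]
      have h3 := norm_upperRiesz_le d (a j) (x - z j)
      have h4 : (upperNorm (a j) (x - z j) ^ d)⁻¹ ≤ (ε ^ d)⁻¹ := by
        gcongr
        refine h2.le.trans ?_
        rw [norm_sub_rev]
        exact norm_le_upperNorm _ _
      have h5 := mul_le_mul_of_nonneg_left (h3.trans h4) hc
      linarith
    · rw [if_neg h1, if_neg h2, sub_zero, norm_zero]
      linarith
  rw [Finset.sum_filter, Finset.sum_filter, ← Finset.sum_sub_distrib]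
  refine (norm_sum_le _ _).trans ((Finset.sum_le_sum fun j _ => hterm j).trans ?_)
  rw [Finset.sum_add_distrib, ← Finset.mul_sum, ← Finset.sum_filter, ← Finset.mul_sum]
  refine add_le_add le_rfl ?_
  calc (ε ^ d)⁻¹ * ∑ j with ‖y j - x‖ ≤ 2 * ε, c j ≤ (ε ^ d)⁻¹ * ((3 ^ d * P) * (2 * ε) ^ d) := by
        gcongr
        exact h.growth_point hx (by linarith)
    _ = _ := by
        rw [mul_pow, show (6 : ℝ) = 3 * 2 by norm_num, mul_pow]
        field_simp

/-- The part of the clustered measure at a distance more than `ε` from `x` has a Riesz transform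
which is almost constant near `x`. -/
theorem norm_sum_far_sub_sum_far_le (h : IsClustering c y z a P r) {x x' : EuclideanSpace ℝ (Fin d)}
    (hx : ∀ j, 20 * a j ≤ ‖z j - x‖) {ε : ℝ} (hε : 0 < ε) (hxx' : ‖x - x'‖ ≤ ε / 2) :
    ‖∑ j with ε < ‖z j - x‖, c j • upperRiesz (d + 1) (a j) (x - z j) -
      ∑ j with ε < ‖z j - x‖, c j • upperRiesz (d + 1) (a j) (x' - z j)‖ ≤
      (d + 2) * 4 ^ (d + 1) * 2 ^ (d + 2) * 6 ^ d * P := by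
  have hP := h.density_pos
  -- A displacement of order `ε` against a kernel gradient of order $|X|^{-d-1}$ produces the
  -- Poisson kernel at height `ε`, summable by growth.
  have hterm : ∀ j ∈ Finset.univ.filter (fun j => ε < ‖z j - x‖),
      ‖c j • upperRiesz (d + 1) (a j) (x - z j) - c j • upperRiesz (d + 1) (a j) (x' - z j)‖ ≤
      (d + 2) * 4 ^ (d + 1) * (c j * upperPoisson (d + 1) ε (z j - x)) := by
    intro j hj
    have hj : ε < ‖z j - x‖ := (Finset.mem_filter.1 hj).2
    have hc := h.nonneg j
    have ha := h.size_pos j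
    have hN := upperNorm_pos ha (x - z j)
    have hN1 := norm_le_upperNorm (a j) (x - z j)
    rw [norm_sub_rev] at hN1
    have hN2 := upperNorm_le_upperNorm_add (a j) (a j) (x - z j) (x' - z j)
    rw [sub_sub_sub_cancel_right, sub_self, abs_zero] at hN2
    have hN3 := upperNorm_le_add hε.le (z j - x)
    have hN4 := upperNorm_pos hε (z j - x)
    have h3 := norm_upperRiesz_sub_le (d + 1) (l := upperNorm ε (z j - x) / 4) (by positivity)
      (t := a j) (t' := a j) (x := x - z j) (x' := x' - z j) (by linarith) (by linarith)
    rw [sub_sub_sub_cancel_right, sub_self, abs_zero, add_zero] at h3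
    have h4 : ‖upperRiesz (d + 1) (a j) (x - z j) - upperRiesz (d + 1) (a j) (x' - z j)‖ ≤
        (d + 2) * 4 ^ (d + 1) * upperPoisson (d + 1) ε (z j - x) := by
      refine h3.trans ?_
      rw [upperPoisson, div_pow, div_div_eq_mul_div, ← mul_div_assoc]
      refine div_le_div_of_nonneg_right ?_ (by positivity)
      push_cast
      calc ((d : ℝ) + 1 + 1) * ‖x - x'‖ * 4 ^ (d + 1)
          ≤ ((d : ℝ) + 1 + 1) * ε * 4 ^ (d + 1) := by gcongr; linarith
        _ = _ := by ring
    rw [← smul_sub, norm_smul, Real.norm_of_nonneg hc]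
    have h5 := mul_le_mul_of_nonneg_left h4 hc
    linarith
  rw [← Finset.sum_sub_distrib]
  refine (norm_sum_le _ _).trans ((Finset.sum_le_sum hterm).trans ?_)
  rw [← Finset.mul_sum]
  have h1 := sum_mul_upperPoisson_le (Finset.univ.filter fun j => ε < ‖z j - x‖) h.nonneg z x hε
    (A := 6 ^ d * P) (by positivity) fun ρ hρ => by
      rw [Finset.filter_filter]
      refine (h.sum_le_sum_filter (q := fun k => ‖z k - x‖ ≤ ρ) fun k hk => hk.2).trans ?_
      exact h.growth_center_point hx (by linarith)
  calc (d + 2) * 4 ^ (d + 1) * ∑ j with ε < ‖z j - x‖, c j * upperPoisson (d + 1) ε (z j - x)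
      ≤ (d + 2) * 4 ^ (d + 1) * (2 ^ (d + 2) * (6 ^ d * P)) := by gcongr
    _ = _ := by ring

end IsClustering

end Clustering

/-! ### Weak type estimates in the critical and supercritical cases -/

section WeakType

variable {d : ℕ}

theorem hasBallCover_maximal_integral {r : ℝ≥0} (hr : 0 < r) (hd : d ≠ 0) {lam : ℝ} (hlam : 0 < lam)
    {f : EuclideanSpace ℝ (Fin d) → ℝ} (hf : Integrable f) (hf0 : ∀ x, 0 ≤ f x) :
    HasBallCover r {x | ∃ ε : ℝ, r ≤ ε ∧ lam * ε ^ d < ∫ z in Metric.closedBall x ε, f z}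
      (ENNReal.ofReal (6 ^ d / lam * ∫ z, f z)) := by
  have h1 : ∫⁻ z, ENNReal.ofReal (f z) = ENNReal.ofReal (∫ z, f z) :=
    (ofReal_integral_eq_lintegral_ofReal hf (ae_of_all _ hf0)).symm
  have hlam' : 0 < lam.toNNReal := Real.toNNReal_pos.2 hlam
  refine (hasBallCover_maximal hr hd hlam' (fun z => ENNReal.ofReal (f z))
    (by rw [h1]; exact ENNReal.ofReal_ne_top)).mono ?_ ?_
  · rintro x ⟨ε, hε, hx⟩
    have hε0 : 0 ≤ ε := r.coe_nonneg.trans hε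
    refine ⟨ε.toNNReal, by rwa [← NNReal.coe_le_coe, Real.coe_toNNReal _ hε0], ?_⟩
    rw [Real.coe_toNNReal _ hε0, ← ofReal_integral_eq_lintegral_ofReal hf.integrableOn
      (ae_of_all _ hf0), ← Real.toNNReal_pow hε0, ← Real.toNNReal_mul hlam.le]
    exact (ENNReal.ofReal_lt_ofReal_iff_of_nonneg (by positivity)).2 hx
  · rw [h1, ENNReal.ofReal_mul (by positivity), ENNReal.ofReal_div_of_pos hlam,
      ENNReal.ofReal_pow (by norm_num)]
    norm_num
    rfl

theorem volume_closedBall_real (x : EuclideanSpace ℝ (Fin d)) {ρ : ℝ} (hρ : 0 < ρ) :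
    volume.real (Metric.closedBall x ρ) =
      ρ ^ d * volume.real (Metric.ball (0 : EuclideanSpace ℝ (Fin d)) 1) := by
  rw [measureReal_def, Measure.addHaar_closedBall _ _ hρ.le, ENNReal.toReal_mul,
    finrank_euclideanSpace_fin, ENNReal.toReal_ofReal (by positivity), measureReal_def]

theorem volume_unitBall_real_pos :
    0 < volume.real (Metric.ball (0 : EuclideanSpace ℝ (Fin d)) 1) :=
  ENNReal.toReal_pos (Metric.measure_ball_pos _ _ one_pos).ne' measure_ball_lt_top.ne

theorem mul_volume_le_setIntegral {f : EuclideanSpace ℝ (Fin d) → ℝ} (hf : Integrable f)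
    (x : EuclideanSpace ℝ (Fin d)) {ρ m : ℝ} (hρ : 0 < ρ)
    (h : ∀ z, ‖x - z‖ ≤ ρ → m ≤ f z) :
    m * (ρ ^ d * volume.real (Metric.ball (0 : EuclideanSpace ℝ (Fin d)) 1)) ≤
      ∫ z in Metric.closedBall x ρ, f z := by
  have h1 : ∫ _ in Metric.closedBall x ρ, m =
      m * (ρ ^ d * volume.real (Metric.ball (0 : EuclideanSpace ℝ (Fin d)) 1)) := by
    rw [setIntegral_const, volume_closedBall_real x hρ, smul_eq_mul, mul_comm]
  rw [← h1]
  refine setIntegral_mono_on (integrableOn_const measure_closedBall_lt_top.ne) hf.integrableOn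
    measurableSet_closedBall fun z hz => h z ?_
  rwa [Metric.mem_closedBall, dist_comm, dist_eq_norm] at hz

/-- Away from the clusters and from the places where the local averages of the square of the Riesz
transform or of the Poisson extension of the clustered measure are large, all truncations of the
Riesz transform are bounded. -/
theorem exists_norm_truncated_le (hd : d ≠ 0) :
    ∃ C : ℝ, 0 < C ∧ ∀ {ι : Type} [Fintype ι] {c : ι → ℝ} {y z : ι → EuclideanSpace ℝ (Fin d)}
      {a : ι → ℝ} {P r : ℝ}, IsClustering c y z a P r → ∀ x : EuclideanSpace ℝ (Fin d),
      (∀ j, 20 * a j ≤ ‖z j - x‖) →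
      (∀ ε, r ≤ ε → ∫ w in Metric.closedBall x ε,
        ‖∑ j, c j • upperRiesz (d + 1) (a j) (w - z j)‖ ^ 2 ≤ P ^ 2 * ε ^ d) →
      (∫ w in Metric.closedBall x r, ∑ j, c j * upperPoisson (d + 1) (a j) (w - z j) ≤ P * r ^ d) →
      ∀ ε, 0 < ε → ‖∑ j with ε < ‖y j - x‖, c j • upperRiesz (d + 1) 0 (x - y j)‖ ≤ C * P := by
  obtain ⟨C₀, hC₀, hL2⟩ := exists_integral_norm_sq_upperRiesz_le hd
  set v := volume.real (Metric.ball (0 : EuclideanSpace ℝ (Fin d)) 1) with hv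
  have hv0 : 0 < v := volume_unitBall_real_pos
  -- The first two terms pay for replacing the masses by clusters, the third for moving from `x` to
  -- a nearby point; `C₂` comes from averaging squares.
  set C₁ : ℝ := (d + 2) * 6 * 2 ^ (d + 1) * (2 ^ (d + 1) / v) + 6 ^ d +
    (d + 2) * 4 ^ (d + 1) * 2 ^ (d + 2) * 6 ^ d with hC₁
  set C₂ : ℝ := 2 * (1 + C₀ * 36 ^ d) * 2 ^ d / v with hC₂
  have hC₁0 : 0 < C₁ := by positivity
  have hC₂0 : 0 < C₂ := by positivity
  refine ⟨C₁ + √C₂, by positivity, fun {ι} _ {c y z a P r} h x hx hG hH => ?_⟩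
  have hP := h.density_pos
  have hr := h.scale_pos
  have hC₁P : 0 ≤ C₁ * P := by positivity
  -- reduction to truncations above the scale `r`
  suffices hmain : ∀ ε, r ≤ ε →
      ‖∑ j with ε < ‖y j - x‖, c j • upperRiesz (d + 1) 0 (x - y j)‖ ≤ (C₁ + √C₂) * P by
    intro ε hε
    rcases le_total r ε with hrε | hrε
    · exact hmain ε hrε
    -- Each `y j` is at distance at least `15 * a j > r` from `x`, so truncating below `r` removes
    -- nothing.
    · have hfar : ∀ j, r < ‖y j - x‖ := fun j => by
        have h1 := norm_sub_norm_le (z j - x) (z j - y j)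
        rw [sub_sub_sub_cancel_left, norm_sub_rev (z j) (y j)] at h1
        linarith [h.norm_sub_le j, hx j, h.scale_le j]
      have := hmain r le_rfl
      rw [Finset.filter_true_of_mem fun j _ => hfar j] at this
      rwa [Finset.filter_true_of_mem fun j _ => hrε.trans_lt (hfar j)]
  intro ε hrε
  have hε : 0 < ε := hr.trans_le hrε
  set H := ∑ j, c j * upperPoisson (d + 1) (a j) (x - z j) with hHdef
  -- All heights are at least `r`, so Harnack's inequality bounds the value at `x` by the average
  -- over the ball of radius `r`.
  have hHle : H ≤ 2 ^ (d + 1) / v * P := by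
    have h1 := mul_volume_le_setIntegral (m := H / 2 ^ (d + 1)) h.integrable_sum_upperPoisson x hr
      (fun w hw => by
        rw [div_le_iff₀ (by positivity), hHdef, Finset.sum_mul]
        refine Finset.sum_le_sum fun j _ => ?_
        have h2 := upperPoisson_le_of_norm_sub_le (d + 1) (h.size_pos j) (x := x - z j)
          (x' := w - z j) (by rw [sub_sub_sub_cancel_right]; exact hw.trans (h.scale_le j))
        have h3 := mul_le_mul_of_nonneg_left h2 (h.nonneg j)
        linarith)
    have h2 := h1.trans hH
    rw [← hv] at h2
    have h3 : H / 2 ^ (d + 1) * v ≤ P := by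
      have hrd : 0 < r ^ d := by positivity
      nlinarith
    rw [div_mul_eq_mul_div, le_div_iff₀ hv0]
    rw [div_mul_eq_mul_div, div_le_iff₀ (by positivity)] at h3
    linarith
  set R := ‖∑ j with ε < ‖y j - x‖, c j • upperRiesz (d + 1) 0 (x - y j)‖ with hR
  set G : EuclideanSpace ℝ (Fin d) → EuclideanSpace ℝ (Fin d) := fun w =>
    ∑ j, c j • upperRiesz (d + 1) (a j) (w - z j) with hGdef
  set L : EuclideanSpace ℝ (Fin d) → EuclideanSpace ℝ (Fin d) := fun w =>
    ∑ j with ‖z j - x‖ ≤ ε, c j • upperRiesz (d + 1) (a j) (w - z j) with hLdef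
  -- Cotlar's comparison: the truncation at `x` is, up to `C₁ * P`, the far part `G w - L w` at
  -- every nearby `w`.
  have hpoint : ∀ w, ‖x - w‖ ≤ ε / 2 → R - C₁ * P ≤ ‖G w‖ + ‖L w‖ := by
    intro w hw
    have h1 := h.norm_sum_sub_sum_le hx hε
    have h2 := h.norm_sum_far_sub_sum_far_le hx hε hw
    have h3 : G w = L w + ∑ j with ε < ‖z j - x‖, c j • upperRiesz (d + 1) (a j) (w - z j) := by
      simp only [hGdef, hLdef, ← not_le]
      rw [Finset.sum_filter_add_sum_filter_not]
    have h4 : ‖∑ j with ε < ‖z j - x‖, c j • upperRiesz (d + 1) (a j) (w - z j)‖ ≤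
        ‖G w‖ + ‖L w‖ := by
      rw [show ∑ j with ε < ‖z j - x‖, c j • upperRiesz (d + 1) (a j) (w - z j) = G w - L w by
        rw [h3]; abel]
      exact norm_sub_le _ _
    have h5 := norm_le_norm_add_norm_sub' (∑ j with ε < ‖y j - x‖, c j • upperRiesz (d + 1) 0 (x - y j))
      (∑ j with ε < ‖z j - x‖, c j • upperRiesz (d + 1) (a j) (x - z j))
    have h6 := norm_le_norm_add_norm_sub'
      (∑ j with ε < ‖z j - x‖, c j • upperRiesz (d + 1) (a j) (x - z j))
      (∑ j with ε < ‖z j - x‖, c j • upperRiesz (d + 1) (a j) (w - z j))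
    have h7 : (d + 2) * 6 * 2 ^ (d + 1) * H ≤
        (d + 2) * 6 * 2 ^ (d + 1) * (2 ^ (d + 1) / v * P) := by gcongr
    have h8 : C₁ * P = (d + 2) * 6 * 2 ^ (d + 1) * (2 ^ (d + 1) / v * P) + 6 ^ d * P +
      (d + 2) * 4 ^ (d + 1) * 2 ^ (d + 2) * 6 ^ d * P := by
      rw [hC₁]
      ring
    linarith
  rcases le_total (R - C₁ * P) 0 with hneg | hposR
  · have : 0 ≤ √C₂ * P := by positivity
    linarith
  have hGL2 := hL2 Finset.univ c a z (6 ^ d * P) h.nonneg h.size_pos (by positivity)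
    fun j _ ρ hρ => h.growth_center j hρ
  -- The near part satisfies the $L^2$ bound with its own mass, which is of order `P * ε ^ d`; its
  -- mean square at scale `ε` is therefore of order `P ^ 2`.
  have hLL2 := hL2 (Finset.univ.filter fun j => ‖z j - x‖ ≤ ε) c a z (6 ^ d * P) h.nonneg h.size_pos
    (by positivity) fun j _ ρ hρ => by
      rw [Finset.filter_filter]
      exact (h.sum_le_sum_filter fun k hk => hk.2).trans (h.growth_center j hρ)
  have hmass := h.growth_center_point hx hε.le
  have hsq : (R - C₁ * P) ^ 2 ≤ C₂ * P ^ 2 := by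
    have h1 := mul_volume_le_setIntegral (m := (R - C₁ * P) ^ 2) (ρ := ε / 2)
      ((hGL2.1.add hLL2.1).const_mul 2) x (by positivity) (fun w hw => by
        have h2 := hpoint w hw
        have h3 : (R - C₁ * P) ^ 2 ≤ (‖G w‖ + ‖L w‖) ^ 2 := by gcongr
        have h4 : (‖G w‖ + ‖L w‖) ^ 2 ≤ 2 * (‖G w‖ ^ 2 + ‖L w‖ ^ 2) := add_sq_le
        exact h3.trans h4)
    have h2 : ∫ w in Metric.closedBall x (ε / 2), 2 * (‖G w‖ ^ 2 + ‖L w‖ ^ 2) ≤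
        2 * (P ^ 2 * ε ^ d + C₀ * (6 ^ d * P) * ((6 ^ d * P) * ε ^ d)) := by
      rw [integral_const_mul, integral_add hGL2.1.integrableOn hLL2.1.integrableOn]
      have h3 : ∫ w in Metric.closedBall x (ε / 2), ‖G w‖ ^ 2 ≤ P ^ 2 * ε ^ d := by
        refine le_trans ?_ (hG ε hrε)
        exact setIntegral_mono_set hGL2.1.integrableOn (ae_of_all _ fun w => by positivity)
          (Metric.closedBall_subset_closedBall (by linarith)).eventuallyLE
      have h4 : ∫ w in Metric.closedBall x (ε / 2), ‖L w‖ ^ 2 ≤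
          C₀ * (6 ^ d * P) * ((6 ^ d * P) * ε ^ d) := by
        refine (setIntegral_le_integral hLL2.1 (ae_of_all _ fun w => by positivity)).trans
          (hLL2.2.trans ?_)
        gcongr
      linarith
    have h3 := h1.trans h2
    have h4 : 0 < ε ^ d := by positivity
    have h5 : (R - C₁ * P) ^ 2 * v ≤ 2 * (1 + C₀ * 36 ^ d) * 2 ^ d * P ^ 2 := by
      rw [← hv, div_pow] at h3
      have h6 : (R - C₁ * P) ^ 2 * (ε ^ d / 2 ^ d * v) = ((R - C₁ * P) ^ 2 * v) / 2 ^ d * ε ^ d := by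
        ring
      have h7 : 2 * (P ^ 2 * ε ^ d + C₀ * (6 ^ d * P) * ((6 ^ d * P) * ε ^ d)) =
          (2 * (1 + C₀ * 36 ^ d) * P ^ 2) * ε ^ d := by
        rw [show (36 : ℝ) = 6 * 6 by norm_num, mul_pow]
        ring
      rw [h6, h7] at h3
      have h8 := le_of_mul_le_mul_right h3 h4
      rw [div_le_iff₀ (by positivity)] at h8
      linarith
    rw [hC₂, div_mul_eq_mul_div, le_div_iff₀ hv0]
    exact h5
  have h1 : R - C₁ * P ≤ √C₂ * P := by
    refine abs_le_of_sq_le_sq' ?_ (by positivity) |>.2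
    rw [mul_pow, Real.sq_sqrt hC₂0.le]
    exact hsq
  linarith

/-- The weak type estimate for the maximal Riesz transform of order `d` of a positive combination
of point masses. -/
theorem exists_hasBallCover_truncated_eq (hd : d ≠ 0) :
    ∃ C : ℝ, 0 < C ∧ ∀ {ι : Type} [Fintype ι] (N : ℕ) (c : ι → ℝ)
      (y : ι → EuclideanSpace ℝ (Fin d)) (P : ℝ) (r : ℝ≥0), Fintype.card ι ≤ N → (∀ j, 0 ≤ c j) →
      0 < P → 0 < r → ∑ j, c j ≤ N * P * (r : ℝ) ^ d →
      HasBallCover r {x | ∃ ε : ℝ, 0 < ε ∧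
        C * P < ‖∑ j with ε < ‖y j - x‖, c j • upperRiesz (d + 1) 0 (x - y j)‖}
        (ENNReal.ofReal (C * N * (r : ℝ) ^ d)) := by
  obtain ⟨C₀, hC₀, hL2⟩ := exists_integral_norm_sq_upperRiesz_le hd
  obtain ⟨C₁, hC₁, hpt⟩ := exists_norm_truncated_le hd
  obtain ⟨C₂, hC₂, hpois⟩ := exists_integral_upperPoisson_le d
  -- The costs of the three covers: the clusters, large averages of the squared transform (`6 ^ d`
  -- from Vitali times `6 ^ d` from growth), and large averages of the Poisson extension.
  set K : ℝ := 20 ^ d * 2 + (36 ^ d * C₀ + 6 ^ d * C₂) with hK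
  have hK0 : 0 < K := by positivity
  refine ⟨C₁ + K, by positivity, fun {ι} _ N c y P r hN hc hP hr hsum => ?_⟩
  have hr' : (0 : ℝ) < r := hr
  obtain ⟨z, a, hcl, hcov⟩ := exists_isClustering hd hc y hP hr
  have hG := hL2 Finset.univ c a z (6 ^ d * P) hc hcl.size_pos (by positivity)
    fun j _ ρ hρ => hcl.growth_center j hρ
  have hcov1 := hasBallCover_maximal_integral hr hd (lam := P ^ 2) (by positivity) hG.1
    (fun x => by positivity)
  have hcov2 := hasBallCover_maximal_integral hr hd hP hcl.integrable_sum_upperPoisson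
    (fun x => Finset.sum_nonneg fun j _ =>
      mul_nonneg (hc j) (upperPoisson_nonneg _ (hcl.size_pos j).le _))
  have hS : (∑ j, c j) / P ≤ N * (r : ℝ) ^ d := by
    rw [div_le_iff₀ hP]
    linarith
  refine (hcov.union (hcov1.union hcov2)).mono ?_ ?_
  · rintro x ⟨ε, hε, hx⟩
    by_contra hnot
    simp only [mem_union, mem_iUnion, mem_ofPred_eq, not_or, not_exists, not_and, not_lt,
      Metric.mem_ball, dist_comm x, dist_eq_norm] at hnot
    obtain ⟨h1, h2, h3⟩ := hnot
    have := hpt hcl x h1 h2 (h3 r le_rfl) ε hε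
    have hKP : 0 < K * P := by positivity
    linarith
  · rw [← ENNReal.ofReal_add, ← ENNReal.ofReal_add]
    rotate_left
    · have := Finset.sum_nonneg fun j (_ : j ∈ Finset.univ) => hc j
      positivity
    · refine add_nonneg ?_ ?_
      · have : 0 ≤ ∫ x, ‖∑ j, c j • upperRiesz (d + 1) (a j) (x - z j)‖ ^ 2 :=
          integral_nonneg fun x => by positivity
        positivity
      · have : 0 ≤ ∫ x, ∑ j, c j * upperPoisson (d + 1) (a j) (x - z j) :=
          integral_nonneg fun x => Finset.sum_nonneg fun j _ =>
            mul_nonneg (hc j) (upperPoisson_nonneg _ (hcl.size_pos j).le _)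
        positivity
    · have : 0 ≤ ∫ x, ‖∑ j, c j • upperRiesz (d + 1) (a j) (x - z j)‖ ^ 2 :=
        integral_nonneg fun x => by positivity
      positivity
    · have : 0 ≤ ∫ x, ∑ j, c j * upperPoisson (d + 1) (a j) (x - z j) :=
        integral_nonneg fun x => Finset.sum_nonneg fun j _ =>
          mul_nonneg (hc j) (upperPoisson_nonneg _ (hcl.size_pos j).le _)
      positivity
    refine ENNReal.ofReal_le_ofReal ?_
    have e1 : (20 : ℝ) ^ d * (Fintype.card ι * (r : ℝ) ^ d + (∑ j, c j) / P) ≤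
        20 ^ d * 2 * (N * (r : ℝ) ^ d) := by
      have : (Fintype.card ι : ℝ) ≤ N := by exact_mod_cast hN
      calc (20 : ℝ) ^ d * (Fintype.card ι * (r : ℝ) ^ d + (∑ j, c j) / P)
          ≤ 20 ^ d * (N * (r : ℝ) ^ d + N * (r : ℝ) ^ d) := by gcongr
        _ = _ := by ring
    have e2 : 6 ^ d / P ^ 2 * ∫ x, ‖∑ j, c j • upperRiesz (d + 1) (a j) (x - z j)‖ ^ 2 ≤
        36 ^ d * C₀ * (N * (r : ℝ) ^ d) := by
      calc 6 ^ d / P ^ 2 * ∫ x, ‖∑ j, c j • upperRiesz (d + 1) (a j) (x - z j)‖ ^ 2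
          ≤ 6 ^ d / P ^ 2 * (C₀ * (6 ^ d * P) * ∑ j, c j) := by gcongr; exact hG.2
        _ = 36 ^ d * C₀ * ((∑ j, c j) / P) := by
            rw [show (36 : ℝ) = 6 * 6 by norm_num, mul_pow]
            field_simp
        _ ≤ _ := by gcongr
    have e3 : 6 ^ d / P * ∫ x, ∑ j, c j * upperPoisson (d + 1) (a j) (x - z j) ≤
        6 ^ d * C₂ * (N * (r : ℝ) ^ d) := by
      have h1 : ∫ x, ∑ j, c j * upperPoisson (d + 1) (a j) (x - z j) ≤ C₂ * ∑ j, c j := by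
        rw [integral_finsetSum _ fun j _ =>
          (integrable_upperPoisson (hcl.size_pos j) (z j)).const_mul (c j), Finset.mul_sum]
        refine Finset.sum_le_sum fun j _ => ?_
        rw [integral_const_mul, mul_comm]
        exact mul_le_mul_of_nonneg_right (hpois _ (hcl.size_pos j) _) (hc j)
      calc 6 ^ d / P * ∫ x, ∑ j, c j * upperPoisson (d + 1) (a j) (x - z j)
          ≤ 6 ^ d / P * (C₂ * ∑ j, c j) := by gcongr
        _ = 6 ^ d * C₂ * ((∑ j, c j) / P) := by ring
        _ ≤ _ := by gcongr
    have e4 : 0 ≤ C₁ * (N * (r : ℝ) ^ d) := by positivity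
    have e5 : (C₁ + K) * N * (r : ℝ) ^ d = C₁ * (N * (r : ℝ) ^ d) + (20 ^ d * 2 * (N * (r : ℝ) ^ d) +
        (36 ^ d * C₀ * (N * (r : ℝ) ^ d) + 6 ^ d * C₂ * (N * (r : ℝ) ^ d))) := by
      rw [hK]
      ring
    linarith

/-- Above the critical exponent, a weak type estimate holds even for the integrals of the absolute
value of the kernel. -/
theorem exists_hasBallCover_potential (hd : d ≠ 0) {s : ℝ} (hs : (d : ℝ) < s) :
    ∃ C : ℝ, 0 < C ∧ ∀ {ι : Type} [Fintype ι] (N : ℕ) (c : ι → ℝ)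
      (y : ι → EuclideanSpace ℝ (Fin d)) (P : ℝ) (r : ℝ≥0), Fintype.card ι ≤ N → (∀ j, 0 ≤ c j) →
      0 < P → 0 < r → ∑ j, c j ≤ N * P * (r : ℝ) ^ s →
      HasBallCover r {x | C * P < ∑ j, c j * ‖y j - x‖ ^ (-s)}
        (ENNReal.ofReal (C * N * (r : ℝ) ^ d)) := by
  obtain ⟨C₀, hC₀, hint⟩ := exists_integral_add_norm_rpow hs
  have hs0 : 0 < s := (Nat.cast_nonneg d).trans_lt hs
  set v := volume.real (Metric.ball (0 : EuclideanSpace ℝ (Fin d)) 1) with hv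
  have hv0 : 0 < v := volume_unitBall_real_pos
  have htwo : (0 : ℝ) < 2 ^ s := Real.rpow_pos_of_pos two_pos s
  refine ⟨2 ^ s * 2 ^ s / v + (2 ^ d + 6 ^ d * C₀), by positivity,
    fun {ι} _ N c y P r hN hc hP hr hsum => ?_⟩
  have hr' : (0 : ℝ) < r := hr
  set f : EuclideanSpace ℝ (Fin d) → ℝ := fun x => ∑ j, c j * ((r : ℝ) + ‖x - y j‖) ^ (-s) with hf
  have hf0 : ∀ x, 0 ≤ f x := fun x => Finset.sum_nonneg fun j _ => mul_nonneg (hc j) (by positivity)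
  have hfint : Integrable f := integrable_finsetSum _ fun j _ => (hint r hr' (y j)).1.const_mul _
  have hhalf : ∀ {u w : ℝ}, 0 < u → 0 < w → u ≤ 2 * w → w ^ (-s) ≤ 2 ^ s * u ^ (-s) := by
    intro u w hu hw h
    rw [Real.rpow_neg hw.le, Real.rpow_neg hu.le, ← div_eq_mul_inv, inv_eq_one_div,
      div_le_div_iff₀ (by positivity) (by positivity), one_mul, ← Real.mul_rpow two_pos.le hw.le]
    exact Real.rpow_le_rpow hu.le h hs0.le
  -- Outside these balls `‖y j - x‖` and `r + ‖y j - x‖` are comparable, so the singular potential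
  -- is at most `2 ^ s * f x`.
  have hcov1 := hasBallCover_biUnion_finset (Finset.univ : Finset ι) (r := r) y (fun _ => 2 * r)
    (fun _ _ => le_mul_of_one_le_left zero_le (by norm_num))
  have hcov2 := hasBallCover_maximal_integral hr hd hP hfint hf0
  refine (hcov1.union hcov2).mono ?_ ?_
  · intro x hx
    by_contra hnot
    simp only [mem_union, mem_iUnion, mem_ofPred_eq, not_or, not_exists, not_and, not_lt,
      Metric.mem_ball, dist_comm x, dist_eq_norm, Finset.mem_univ, true_imp_iff] at hnot
    obtain ⟨h1, h2⟩ := hnot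
    have h3 := h2 r le_rfl
    have h4 : ∑ j, c j * ‖y j - x‖ ^ (-s) ≤ 2 ^ s * f x := by
      rw [hf, Finset.mul_sum]
      refine Finset.sum_le_sum fun j _ => ?_
      have h5 := h1 j
      push_cast at h5
      have h6 := hhalf (u := r + ‖x - y j‖) (w := ‖y j - x‖) (by positivity) (by linarith)
        (by rw [norm_sub_rev x]; linarith)
      have h7 := mul_le_mul_of_nonneg_left h6 (hc j)
      linarith
    -- Moving by at most `r` at most doubles `r + ‖x - y j‖`, so `f` changes by a factor of at most
    -- `2 ^ s` and `f x` is controlled by its average.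
    have h5 := mul_volume_le_setIntegral (m := f x / 2 ^ s) hfint x hr' (fun w hw => by
      rw [div_le_iff₀ htwo, hf, Finset.sum_mul]
      refine Finset.sum_le_sum fun j _ => ?_
      have h6 := hhalf (u := r + ‖w - y j‖) (w := r + ‖x - y j‖) (by positivity) (by positivity)
        (by
          have := norm_sub_le_norm_sub_add_norm_sub w x (y j)
          rw [norm_sub_rev w x] at this
          linarith [norm_nonneg (x - y j)])
      have h7 := mul_le_mul_of_nonneg_left h6 (hc j)
      linarith)
    have h6 := h5.trans h3
    rw [← hv] at h6
    have h7 : f x / 2 ^ s * v ≤ P := by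
      have hrd : 0 < (r : ℝ) ^ d := by positivity
      nlinarith
    have h8 : 2 ^ s * f x ≤ 2 ^ s * 2 ^ s / v * P := by
      rw [div_mul_eq_mul_div, div_le_iff₀ htwo] at h7
      rw [div_mul_eq_mul_div, le_div_iff₀ hv0]
      have h9 := mul_le_mul_of_nonneg_left h7 htwo.le
      linarith
    have h9 : 0 ≤ (2 ^ d + 6 ^ d * C₀) * P := by positivity
    rw [mem_ofPred_eq] at hx
    linarith
  · have e1 : ∑ _i : ι, ((2 * r : ℝ≥0) : ℝ≥0∞) ^ d =
        ENNReal.ofReal (Fintype.card ι * (2 * (r : ℝ)) ^ d) := by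
      rw [Finset.sum_const, nsmul_eq_mul, ENNReal.ofReal_mul (by positivity),
        ENNReal.ofReal_pow (by positivity), ENNReal.ofReal_natCast, Finset.card_univ]
      congr 2
      rw [ENNReal.ofReal, ENNReal.coe_inj, ← NNReal.coe_inj, Real.coe_toNNReal _ (by positivity)]
      push_cast
      rfl
    have hfI : 0 ≤ ∫ z, f z := integral_nonneg hf0
    rw [e1, ← ENNReal.ofReal_add (by positivity) (by positivity)]
    refine ENNReal.ofReal_le_ofReal ?_
    have e2 : ∫ z, f z = C₀ * (r : ℝ) ^ ((d : ℝ) - s) * ∑ j, c j := by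
      rw [hf, integral_finsetSum _ fun j _ => (hint r hr' (y j)).1.const_mul (c j), Finset.mul_sum]
      refine Finset.sum_congr rfl fun j _ => ?_
      rw [integral_const_mul, (hint r hr' (y j)).2, mul_comm]
    have e3 : 6 ^ d / P * ∫ z, f z ≤ 6 ^ d * C₀ * (N * (r : ℝ) ^ d) := by
      rw [e2]
      calc 6 ^ d / P * (C₀ * (r : ℝ) ^ ((d : ℝ) - s) * ∑ j, c j)
          ≤ 6 ^ d / P * (C₀ * (r : ℝ) ^ ((d : ℝ) - s) * (N * P * (r : ℝ) ^ s)) := by gcongr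
        _ = 6 ^ d * C₀ * (N * ((r : ℝ) ^ ((d : ℝ) - s) * (r : ℝ) ^ s)) := by field_simp
        _ = _ := by rw [← Real.rpow_add hr', sub_add_cancel, Real.rpow_natCast]
    have e4 : (Fintype.card ι : ℝ) * (2 * (r : ℝ)) ^ d ≤ 2 ^ d * (N * (r : ℝ) ^ d) := by
      have : (Fintype.card ι : ℝ) ≤ N := by exact_mod_cast hN
      calc (Fintype.card ι : ℝ) * (2 * (r : ℝ)) ^ d ≤ N * (2 * (r : ℝ)) ^ d := by gcongr
        _ = _ := by rw [mul_pow]; ring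
    have e5 : 0 ≤ 2 ^ s * 2 ^ s / v * (N * (r : ℝ) ^ d) := by positivity
    linarith

end WeakType

/-! ### From complex to nonnegative weights -/

section Complexification

variable {d : ℕ}

theorem norm_toLp_ofReal (v : EuclideanSpace ℝ (Fin d)) :
    ‖(WithLp.toLp 2 fun i => ((v i : ℝ) : ℂ) : EuclideanSpace ℂ (Fin d))‖ = ‖v‖ := by
  simp [EuclideanSpace.norm_eq]

theorem norm_rieszKernel_le {s : ℝ} {v : EuclideanSpace ℝ (Fin d)} (hv : v ≠ 0) :
    ‖rieszKernel d s v‖ ≤ ‖v‖ ^ (-s) := by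
  have h0 : 0 < ‖v‖ := norm_pos_iff.2 hv
  have h1 : rieszKernel d s v =
      WithLp.toLp 2 fun i => (((((‖v‖ ^ (s + 1))⁻¹ • v : EuclideanSpace ℝ (Fin d)) i : ℝ)) : ℂ) := by
    unfold rieszKernel
    congr 1
    funext i
    rw [PiLp.smul_apply, smul_eq_mul, div_eq_inv_mul]
  rw [h1, norm_toLp_ofReal, norm_smul, Real.norm_of_nonneg (by positivity), Real.rpow_add h0,
    Real.rpow_one, Real.rpow_neg h0.le]
  refine le_of_eq ?_
  field_simp

theorem rieszKernel_natCast (v : EuclideanSpace ℝ (Fin d)) :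
    rieszKernel d d v =
      WithLp.toLp 2 fun i => (((upperRiesz (d + 1) 0 v : EuclideanSpace ℝ (Fin d)) i : ℝ) : ℂ) := by
  unfold rieszKernel upperRiesz
  congr 1
  funext i
  rw [PiLp.smul_apply, smul_eq_mul, upperNorm_zero_left, div_eq_inv_mul, ← Nat.cast_succ,
    Real.rpow_natCast]

theorem upperRiesz_neg (n : ℕ) (t : ℝ) (v : EuclideanSpace ℝ (Fin d)) :
    upperRiesz n t (-v) = -upperRiesz n t v := by
  rw [upperRiesz, upperRiesz, upperNorm_neg, smul_neg]

/-- The stopping radii and clusters require nonnegative weights; positive and negative parts are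
treated separately. -/
theorem norm_sum_smul_sub_le {E ι : Type*} [NormedAddCommGroup E] [NormedSpace ℝ E] (S : Finset ι)
    (t : ι → ℝ) (u : ι → E) :
    ‖∑ j ∈ S, t j • u j‖ ≤ ‖∑ j ∈ S, (max (t j) 0) • u j‖ + ‖∑ j ∈ S, (max (-t j) 0) • u j‖ := by
  have h : ∑ j ∈ S, t j • u j = ∑ j ∈ S, (max (t j) 0) • u j - ∑ j ∈ S, (max (-t j) 0) • u j := by
    rw [← Finset.sum_sub_distrib]
    refine Finset.sum_congr rfl fun j _ => ?_
    rw [← sub_smul, max_zero_sub_max_neg_zero_eq_self]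
  rw [h]
  exact norm_sub_le _ _

theorem norm_sum_smul_toLp_le {ι : Type*} (S : Finset ι) (c : ι → ℂ)
    (u : ι → EuclideanSpace ℝ (Fin d)) :
    ‖∑ j ∈ S, c j • (WithLp.toLp 2 fun i => ((u j i : ℝ) : ℂ) : EuclideanSpace ℂ (Fin d))‖ ≤
      ‖∑ j ∈ S, (c j).re • u j‖ + ‖∑ j ∈ S, (c j).im • u j‖ := by
  have h : ∑ j ∈ S, c j • (WithLp.toLp 2 fun i => ((u j i : ℝ) : ℂ) : EuclideanSpace ℂ (Fin d)) =
      WithLp.toLp 2 (fun i => (((∑ j ∈ S, (c j).re • u j) i : ℝ) : ℂ)) +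
        Complex.I • WithLp.toLp 2 (fun i => (((∑ j ∈ S, (c j).im • u j) i : ℝ) : ℂ)) := by
    ext i
    simp only [WithLp.ofLp_sum, WithLp.ofLp_smul, Finset.sum_apply, Pi.smul_apply, smul_eq_mul,
      PiLp.add_apply, PiLp.smul_apply, Complex.ofReal_sum, Complex.ofReal_mul, Finset.mul_sum,
      ← Finset.sum_add_distrib]
    refine Finset.sum_congr rfl fun j _ => ?_
    conv_lhs => rw [← Complex.re_add_im (c j)]
    ring
  rw [h]
  refine (norm_add_le _ _).trans ?_
  rw [norm_smul, Complex.norm_I, one_mul, norm_toLp_ofReal, norm_toLp_ofReal]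

end Complexification

/-! ### The weak type estimate for complex weights and the theorem -/

section Main

variable {d : ℕ}

/-- The weak type estimate for the truncated Riesz transforms of a combination of point masses. -/
theorem exists_hasBallCover_riesz (hd : d ≠ 0) {s : ℝ} (hs : (d : ℝ) ≤ s) :
    ∃ C : ℝ, 0 < C ∧ ∀ (N : ℕ) (F : Finset (EuclideanSpace ℝ (Fin d)))
      (c : EuclideanSpace ℝ (Fin d) → ℂ) (P : ℝ) (r : ℝ≥0), F.card ≤ N → 0 < P → 0 < r →
      ∑ p ∈ F, ‖c p‖ ≤ N * P * (r : ℝ) ^ s →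
      HasBallCover r {x | ∃ ε : ℝ, 0 < ε ∧
        C * P < ‖∑ p ∈ F with ε < ‖p - x‖, c p • rieszKernel d s (p - x)‖}
        (ENNReal.ofReal (C * N * (r : ℝ) ^ d)) := by
  classical
  rcases hs.eq_or_lt with rfl | hs
  · obtain ⟨C, hC, h⟩ := exists_hasBallCover_truncated_eq hd
    -- Positive and negative parts of the real and imaginary parts give four measures; if none
    -- exceeds `C * P`, their sum does not exceed `4 * C * P`.
    refine ⟨4 * C, by positivity, fun N F c P r hN hP hr hsum => ?_⟩
    rw [Real.rpow_natCast] at hsum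
    have key : ∀ g : EuclideanSpace ℝ (Fin d) → ℝ, (∀ p, 0 ≤ g p) → (∀ p, g p ≤ ‖c p‖) →
        HasBallCover r {x | ∃ ε : ℝ, 0 < ε ∧
          C * P < ‖∑ p ∈ F with ε < ‖p - x‖, g p • upperRiesz (d + 1) 0 (p - x)‖}
          (ENNReal.ofReal (C * N * (r : ℝ) ^ d)) := by
      intro g hg0 hg
      refine (h (ι := F) N (fun p => g p) (fun p => p) P r (by simpa using hN) (fun p => hg0 p) hP hr
        ?_).mono ?_ le_rfl
      · rw [Finset.sum_coe_sort F g]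
        exact (Finset.sum_le_sum fun p _ => hg p).trans hsum
      · rintro x ⟨ε, hε, hx⟩
        refine ⟨ε, hε, hx.trans_eq ?_⟩
        rw [Finset.sum_filter, Finset.sum_filter, ← norm_neg, ← Finset.sum_coe_sort F,
          ← Finset.sum_neg_distrib]
        congr 1
        refine Finset.sum_congr rfl fun p _ => ?_
        split_ifs
        · rw [← smul_neg, ← upperRiesz_neg, neg_sub]
        · simp
    refine (((key (fun p => max (c p).re 0) (fun p => le_max_right _ _) fun p => ?_).union
      (key (fun p => max (-(c p).re) 0) (fun p => le_max_right _ _) fun p => ?_)).union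
      ((key (fun p => max (c p).im 0) (fun p => le_max_right _ _) fun p => ?_).union
      (key (fun p => max (-(c p).im) 0) (fun p => le_max_right _ _) fun p => ?_))).mono ?_ ?_
    · exact max_le ((le_abs_self _).trans (Complex.abs_re_le_norm _)) (norm_nonneg _)
    · exact max_le ((neg_le_abs _).trans (Complex.abs_re_le_norm _)) (norm_nonneg _)
    · exact max_le ((le_abs_self _).trans (Complex.abs_im_le_norm _)) (norm_nonneg _)
    · exact max_le ((neg_le_abs _).trans (Complex.abs_im_le_norm _)) (norm_nonneg _)
    · rintro x ⟨ε, hε, hx⟩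
      by_contra hnot
      simp only [mem_union, mem_ofPred_eq, not_or, not_exists, not_and, not_lt] at hnot
      obtain ⟨⟨h1, h2⟩, h3, h4⟩ := hnot
      have k1 := h1 ε hε
      have k2 := h2 ε hε
      have k3 := h3 ε hε
      have k4 := h4 ε hε
      simp only [rieszKernel_natCast] at hx
      have k5 := norm_sum_smul_toLp_le (F.filter fun p => ε < ‖p - x‖) c
        fun p => upperRiesz (d + 1) 0 (p - x)
      have k6 := norm_sum_smul_sub_le (F.filter fun p => ε < ‖p - x‖) (fun p => (c p).re)
        fun p => upperRiesz (d + 1) 0 (p - x)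
      have k7 := norm_sum_smul_sub_le (F.filter fun p => ε < ‖p - x‖) (fun p => (c p).im)
        fun p => upperRiesz (d + 1) 0 (p - x)
      linarith
    · have h0 : 0 ≤ C * N * (r : ℝ) ^ d := by positivity
      rw [← ENNReal.ofReal_add h0 h0, ← ENNReal.ofReal_add (by positivity) (by positivity)]
      exact ENNReal.ofReal_le_ofReal (by linarith)
  · obtain ⟨C, hC, h⟩ := exists_hasBallCover_potential hd hs
    refine ⟨C, hC, fun N F c P r hN hP hr hsum => ?_⟩
    refine (h (ι := F) N (fun p => ‖c p‖) (fun p => p) P r (by simpa using hN)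
      (fun p => norm_nonneg _) hP hr ?_).mono ?_ le_rfl
    · rwa [Finset.sum_coe_sort F fun p => ‖c p‖]
    · rintro x ⟨ε, hε, hx⟩
      rw [mem_ofPred_eq, Finset.sum_coe_sort F fun p => ‖c p‖ * ‖p - x‖ ^ (-s)]
      refine hx.trans_le ((norm_sum_le _ _).trans ?_)
      refine le_trans (Finset.sum_le_sum fun p hp => ?_)
        (Finset.sum_le_sum_of_subset_of_nonneg (Finset.filter_subset (fun p => ε < ‖p - x‖) F)
          fun p _ _ => by positivity)
      rw [norm_smul]
      gcongr
      exact norm_rieszKernel_le (norm_pos_iff.1 (hε.trans (Finset.mem_filter.1 hp).2))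

end Main

theorem theorem4p4 (d : ℕ) (hd : 1 ≤ d) (s : ℝ) (hs : (d : ℝ) ≤ s) :
    ∃ C : ℝ≥0, 0 < C ∧
      ∀ h : ℝ≥0 → ℝ≥0, IsMeasuringFunction d h →
      ∀ N : ℕ, 2 ≤ N → ∀ P : ℝ≥0, 0 < P →
      ∀ ν : ComplexMeasure (EuclideanSpace ℝ (Fin d)), IsPointMassCombination N ν →
        hausdorffContent h (maximalRieszSet s ν P) ≤
          ((C * N * h ((totalMass ν / (P * N)) ^ (1 / s)) : ℝ≥0) : ℝ≥0∞) := by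
  classical
  have hd0 : d ≠ 0 := by omega
  have hs1 : 1 ≤ s := le_trans (by exact_mod_cast hd) hs
  obtain ⟨C, hC, key⟩ := exists_hasBallCover_riesz hd0 hs
  lift C to ℝ≥0 using hC.le
  have hC' : 0 < C := hC
  have hκ1 : 1 ≤ C + 1 := le_add_of_nonneg_left zero_le
  -- The weak type estimate is applied at level `P / C` and radius `(C + 1) * r₀`. The mass
  -- condition holds because `(C + 1) ^ s ≥ C` for `s ≥ 1`, and returning to `h r₀` costs `(C + 1) ^
  -- d`.
  refine ⟨C * (C + 1) ^ d, by positivity, fun h hh N hN P hP ν hν => ?_⟩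
  obtain ⟨F, c, hcard, hν, hmass⟩ := hν.exists_repr
  have hZ : maximalRieszSet s ν P ⊆ {x | ∃ ε : ℝ, 0 < ε ∧
      (P : ℝ) < ‖∑ p ∈ F with ε < ‖p - x‖, c p • rieszKernel d s (p - x)‖} := by
    intro x hx
    obtain ⟨ε, hε⟩ := lt_iSup_iff.1 (show (P : ℝ≥0∞) < maximalRiesz s ν x from hx)
    obtain ⟨hε0, hε⟩ := lt_iSup_iff.1 hε
    refine ⟨ε, hε0, ?_⟩
    rw [hν, truncatedRiesz_sum_dirac, enorm_eq_nnnorm, ENNReal.coe_lt_coe] at hε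
    exact hε
  set r₀ : ℝ≥0 := (totalMass ν / (P * N)) ^ (1 / s) with hr₀
  have hN0 : (0 : ℝ≥0) < N := by
    have : 0 < N := by omega
    exact_mod_cast this
  -- For zero mass `r₀ = 0`, whereas the covering estimates need a positive radius; the set is then
  -- empty.
  rcases (zero_le : 0 ≤ totalMass ν).eq_or_lt with hm | hm
  · have hc0 : ∀ p ∈ F, c p = 0 := by
      rw [← hm, NNReal.coe_zero] at hmass
      intro p hp
      have := Finset.single_le_sum (f := fun p => ‖c p‖) (fun p _ => norm_nonneg _) hp
      exact norm_le_zero_iff.1 (this.trans hmass)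
    have hempty : maximalRieszSet s ν P = ∅ := by
      refine eq_empty_of_subset_empty fun x hx => ?_
      obtain ⟨ε, -, hx⟩ := hZ hx
      rw [Finset.sum_eq_zero fun p hp => by rw [hc0 p (Finset.mem_filter.1 hp).1, zero_smul],
        norm_zero] at hx
      exact absurd hx (not_lt.2 P.coe_nonneg)
    have hcov : HasBallCover (d := d) 1 ∅ 0 :=
      ⟨∅, countable_empty, by simp, empty_subset _, by simp⟩
    rw [hempty]
    refine (hcov.hausdorffContent_le hh one_pos).trans ?_
    simp
  · have hr₀pos : 0 < r₀ := NNReal.rpow_pos (by positivity)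
    set r : ℝ≥0 := (C + 1) * r₀ with hr
    have hrpos : 0 < r := by positivity
    have hrs : (totalMass ν : ℝ) ≤ N * (P / C : ℝ≥0) * (r : ℝ) ^ s := by
      have h1 : totalMass ν = N * P * r₀ ^ s := by
        rw [hr₀, ← NNReal.rpow_mul, one_div_mul_cancel (by linarith), NNReal.rpow_one]
        field_simp
      have h2 : C ≤ (C + 1) ^ s := by
        calc C ≤ (C + 1) ^ (1 : ℝ) := by rw [NNReal.rpow_one]; exact le_self_add
          _ ≤ (C + 1) ^ s := NNReal.rpow_le_rpow_of_exponent_le hκ1 hs1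
      have h3 : totalMass ν ≤ N * (P / C) * r ^ s := by
        rw [hr, NNReal.mul_rpow, h1]
        calc N * P * r₀ ^ s = N * (P / C) * (C * r₀ ^ s) := by field_simp
          _ ≤ _ := by gcongr
      exact_mod_cast h3
    have hcover := key N F c (P / C : ℝ≥0) r hcard (by positivity) hrpos (hmass.trans hrs)
    have hPC : (C : ℝ) * (P / C : ℝ≥0) = P := by
      rw [← NNReal.coe_mul, mul_div_cancel₀ _ hC'.ne']
    rw [hPC] at hcover
    refine ((hcover.mono hZ le_rfl).hausdorffContent_le hh hrpos).trans ?_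
    have h1 : ENNReal.ofReal ((C : ℝ) * N * (r : ℝ) ^ d) = (C * N * r ^ d : ℝ≥0) := by
      rw [← ENNReal.ofReal_coe_nnreal]
      push_cast
      rfl
    have h2 : h r ≤ (C + 1) ^ d * h r₀ := by
      have h3 := hh.map_mul_pow_le hr₀pos (le_mul_of_one_le_left zero_le hκ1 : r₀ ≤ r)
      rw [mul_pow, ← mul_assoc] at h3
      rw [mul_comm]
      exact le_of_mul_le_mul_right h3 (pow_pos hr₀pos d)
    rw [h1, ← ENNReal.coe_mul, ENNReal.coe_le_coe]
    calc C * N * r ^ d * (h r / r ^ d) = C * N * h r := by field_simp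
      _ ≤ C * N * ((C + 1) ^ d * h r₀) := by gcongr
      _ = C * (C + 1) ^ d * N * h r₀ := by ring
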